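/- A clutter $\mathcal{C}$ over a finite ground set $V$ is a family of subsets of $V$, called members, none of which contains another. A cover is a subset of $V$ that intersects every member; the covering number is the minimum cardinality of a cover, and a minimum cover is a cover of that cardinality. The blocker $b(\mathcal{C})$ is the clutter over $V$ whose members are the inclusion-wise minimal covers of $\mathcal{C}$. For disjoint $I,J\subseteq V$, the minor $\mathcal{C}\setminus I/J$ is the clutter over $V-(I\cup J)$ whose members are the inclusion-wise minimal sets in $\{C-J : C\in\mathcal{C},\ C\cap I=\emptyset\}$. A delta is a clutter over a ground set $\{a_1,\dots,a_n\}$ of cardinality $n\ge 3$ whose members are $\{a_2,\dots,a_n\}$ and $\{a_1,a_i\}$, $i=2,\dots,n$. An extended odd hole is a clutter over a ground set $\{a_1,\dots,a_n\}$ of odd cardinality $n\ge 5$ whose minimum cardinality members are exactly $\{a_1,a_2\},\{a_2,a_3\},\dots,\{a_{n-1},a_n\},\{a_n,a_1\}$. A clutter is clean if none of its minors is a delta or the blocker of an extended odd hole. A clutter is tangled if its covering number is two and every element of $V$ belongs to a minimum cover. The rank of a clean tangled clutter $\mathcal{C}$ is the number of connected components of the graph $G(\mathcal{C})$ on vertex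 set $V$ whose edges are the minimum covers of $\mathcal{C}$. A fractional packing of $\mathcal{C}$ is a vector $y\in\mathbb{R}^{\mathcal{C}}$ with $y\ge \mathbf{0}$ and $\sum (y_C : v\in C\in\mathcal{C})\le 1$ for every $v\in V$; its value is $\sum_{C\in\mathcal{C}} y_C$. Let $\mathbb{L}_7$ be the clutter over $\{1,\dots,7\}$ with members $\{1,2,3\},\{1,4,5\},\{1,6,7\},\{2,5,6\},\{2,4,7\},\{3,4,6\},\{3,5,7\}$. **Proposition.** Let $\mathcal{C}$ be a clean tangled clutter of rank seven that has a unique fractional packing of value two. Then $\mathcal{C}$ has an $\mathbb{L}_7$ minor, that is, some minor of $\mathcal{C}$ is equal to $\mathbb{L}_7$ up to relabeling its elements. -/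

import Mathlib

/-- A clutter on a finite ground set: a family of subsets, none containing another. -/
structure Clutter (α : Type*) where
  ground : Finset α
  members : Finset (Finset α)
  subset_ground : ∀ C ∈ members, C ⊆ ground
  antichain : ∀ C ∈ members, ∀ D ∈ members, C ⊆ D → C = D

namespace Clutter

variable {α β : Type*}

/-- A cover: a set of elements intersecting every member. -/
def IsCover [DecidableEq α] (𝒞 : Clutter α) (B : Finset α) : Prop :=
  B ⊆ 𝒞.ground ∧ ∀ C ∈ 𝒞.members, (B ∩ C).Nonempty

open Classical in
/-- The blocker: the clutter of the inclusion-wise minimal covers, on the same ground set. -/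
noncomputable def blocker [DecidableEq α] (𝒞 : Clutter α) : Clutter α where
  ground := 𝒞.ground
  members := 𝒞.ground.powerset.filter fun B => Minimal 𝒞.IsCover B
  subset_ground := by
    intro B hB
    exact (Finset.mem_filter.1 hB).2.prop.1
  antichain := by
    intro B hB D hD h
    exact (Finset.mem_filter.1 hD).2.eq_of_le (Finset.mem_filter.1 hB).2.prop h

/-- The family `{C - J : C ∈ 𝒞, C ∩ I = ∅}`. -/
def minorFamily [DecidableEq α] (𝒞 : Clutter α) (I J : Finset α) : Finset (Finset α) :=
  (𝒞.members.filter fun C => Disjoint C I).image fun C => C \ J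

open Classical in
/-- The minor `𝒞 \ I / J`, obtained by deleting `I` and contracting `J`. -/
noncomputable def minor [DecidableEq α] (𝒞 : Clutter α) (I J : Finset α) : Clutter α where
  ground := 𝒞.ground \ (I ∪ J)
  members := (𝒞.minorFamily I J).filter fun D => Minimal (fun E => E ∈ 𝒞.minorFamily I J) D
  subset_ground := by
    intro D hD
    obtain ⟨C, hC, rfl⟩ := Finset.mem_image.1 (Finset.mem_filter.1 hD).1
    obtain ⟨hC, hdisj⟩ := Finset.mem_filter.1 hC
    intro v hv
    obtain ⟨hvC, hvJ⟩ := Finset.mem_sdiff.1 hv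
    have hvI : v ∉ I := Finset.disjoint_left.1 hdisj hvC
    simp [𝒞.subset_ground C hC hvC, hvI, hvJ]
  antichain := by
    intro C hC D hD h
    exact (Finset.mem_filter.1 hD).2.eq_of_le (Finset.mem_filter.1 hC).1 h

/-- `ℳ` is a minor of `𝒞`. -/
def IsMinor [DecidableEq α] (ℳ 𝒞 : Clutter α) : Prop :=
  ∃ I J : Finset α, I ⊆ 𝒞.ground ∧ J ⊆ 𝒞.ground ∧ Disjoint I J ∧ ℳ = 𝒞.minor I J

/-- A delta: the ground set is `{a₁, …, aₙ}` with `n ≥ 3`, and the members are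
`{a₂, …, aₙ}` and `{a₁, aᵢ}` for `i = 2, …, n`. -/
def IsDelta [DecidableEq α] (𝒞 : Clutter α) : Prop :=
  ∃ (n : ℕ) (a : ℕ → α), 3 ≤ n ∧ Set.InjOn a (Set.Icc 1 n) ∧
    𝒞.ground = (Finset.Icc 1 n).image a ∧
    𝒞.members = insert ((Finset.Icc 2 n).image a)
      ((Finset.Icc 2 n).image fun i => {a 1, a i})

/-- The members of minimum cardinality. -/
def minMembers (𝒞 : Clutter α) : Finset (Finset α) :=
  𝒞.members.filter fun C => ∀ D ∈ 𝒞.members, C.card ≤ D.card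

/-- An extended odd hole: the ground set is `{a₁, …, aₙ}` with `n ≥ 5` odd, and the members of
minimum cardinality are `{a₁, a₂}, …, {aₙ₋₁, aₙ}, {aₙ, a₁}`. -/
def IsExtendedOddHole [DecidableEq α] (𝒞 : Clutter α) : Prop :=
  ∃ (n : ℕ) (a : ℕ → α), 5 ≤ n ∧ Odd n ∧ Set.InjOn a (Set.Icc 1 n) ∧
    𝒞.ground = (Finset.Icc 1 n).image a ∧
    𝒞.minMembers = insert {a n, a 1} ((Finset.Ico 1 n).image fun i => {a i, a (i + 1)})

/-- A clutter is clean if no minor of it is a delta or the blocker of an extended odd hole. -/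
def IsClean [DecidableEq α] (𝒞 : Clutter α) : Prop :=
  ∀ ℳ : Clutter α, ℳ.IsMinor 𝒞 →
    ¬ ℳ.IsDelta ∧ ¬ ∃ ℋ : Clutter α, ℋ.IsExtendedOddHole ∧ ℳ = ℋ.blocker

/-- The covering number: the minimum cardinality of a cover (`⊤` if there is no cover). -/
noncomputable def coveringNumber [DecidableEq α] (𝒞 : Clutter α) : ℕ∞ :=
  ⨅ B : {B : Finset α // 𝒞.IsCover B}, (B.1.card : ℕ∞)

/-- A minimum cover: a cover whose cardinality is the covering number. -/
def IsMinimumCover [DecidableEq α] (𝒞 : Clutter α) (B : Finset α) : Prop :=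
  𝒞.IsCover B ∧ (B.card : ℕ∞) = 𝒞.coveringNumber

/-- A clutter is tangled if it has covering number two and every element is in a minimum cover. -/
def IsTangled [DecidableEq α] (𝒞 : Clutter α) : Prop :=
  𝒞.coveringNumber = 2 ∧ ∀ v ∈ 𝒞.ground, ∃ B, 𝒞.IsMinimumCover B ∧ v ∈ B

/-- The graph `G(𝒞)` on the ground set, whose edges are the minimum covers (which have two
elements when `𝒞` is tangled). -/
def coverGraph [DecidableEq α] (𝒞 : Clutter α) : SimpleGraph {v // v ∈ 𝒞.ground} where
  Adj u v := u ≠ v ∧ 𝒞.IsMinimumCover {u.1, v.1}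
  symm := ⟨fun u v h => ⟨h.1.symm, by rw [Finset.pair_comm]; exact h.2⟩⟩
  loopless := ⟨fun _ h => h.1 rfl⟩

/-- The rank: the number of connected components of `G(𝒞)`. -/
noncomputable def rank [DecidableEq α] (𝒞 : Clutter α) : ℕ :=
  Nat.card 𝒞.coverGraph.ConnectedComponent

/-- A fractional packing: nonnegative real weights on the members such that the members
containing any given element have total weight at most one. -/
def IsFractionalPacking [DecidableEq α] (𝒞 : Clutter α) (y : {C // C ∈ 𝒞.members} → ℝ) : Prop :=
  (∀ C, 0 ≤ y C) ∧ ∀ v ∈ 𝒞.ground, ∑ C with v ∈ C.1, y C ≤ 1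

/-- The value of a vector of weights on the members. -/
def packingValue (𝒞 : Clutter α) (y : {C // C ∈ 𝒞.members} → ℝ) : ℝ :=
  ∑ C, y C

/-- Two clutters are isomorphic if they agree up to relabeling the elements. -/
def IsIsomorphic (𝒞 : Clutter α) (𝒟 : Clutter β) : Prop :=
  ∃ e : {v // v ∈ 𝒞.ground} ≃ {v // v ∈ 𝒟.ground}, ∀ S : Finset {v // v ∈ 𝒞.ground},
    S.map (Function.Embedding.subtype _) ∈ 𝒞.members ↔
      (S.map e.toEmbedding).map (Function.Embedding.subtype _) ∈ 𝒟.members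

/-- The clutter `𝕃₇` of the lines of the Fano plane. -/
def fanoLines : Clutter ℕ where
  ground := {1, 2, 3, 4, 5, 6, 7}
  members := {{1, 2, 3}, {1, 4, 5}, {1, 6, 7}, {2, 5, 6}, {2, 4, 7}, {3, 4, 6}, {3, 5, 7}}
  subset_ground := by decide
  antichain := by decide

end Clutter

/-! Fix a set of deleted elements and a set of kept elements, contract the rest, and join two kept
elements when, with the deleted set, they meet every member. Excluding deltas and blockers of
extended odd holes makes this graph bipartite as soon as the minor has covering number at least two
(`IsClean.not_odd`). More strongly, no set of vertices pairwise joined by even walks is a cover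
(`IsClean.not_hits_of_even`). Hence one side of a component can be deleted and the other contracted
while the covering number stays at least two (`IsClean.loose_side`).

Iterating over the components produces a probability measure on the members with all marginals 1/2
(`IsClean.exists_isHalfPacking`), carried by members that contain exactly one end of every edge.
Twice this measure is a packing of value two, so it is unique. It is therefore the average of the
two measures obtained by deleting either side of a component, which makes the signs on distinct
components pairwise uncorrelated. Perturbing by the reproducing kernel of the signs and using
uniqueness again (`weight_mul_kernel`), each transversal member has weight 1/8 and two of them agree
on exactly three of the seven components. Eight such words form the code of the Fano plane up to
relabeling and translation, and this is recorded as a `Frame`.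

Three sides on a line whose signs have even sum meet every transversal member. The hard step is that
they meet all members (`Frame.hits_line`): an exception would force exceptions on other lines, with
contradictory signs. Next, each side `X i false` is shrunk to one element while these covers survive
(`Frame.exists_center`); the element is found by a shortest walk argument. Contracting all but the
seven chosen elements gives a clutter for which every line is a cover, while the words supply
members whose traces are the lines. The Fano plane is its own blocker, so this minor is `𝕃₇`. -/

/-! ### Walks with parity, and shortest odd closed walks. -/

namespace SimpleGraph

variable {α : Type*}

/-- There is a walk from `u` to `v` whose length has parity `b`. -/
def ParityReachable (G : SimpleGraph α) (b : Bool) (u v : α) : Prop :=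
  ∃ p : G.Walk u v, p.length.bodd = b

namespace ParityReachable

variable {G H : SimpleGraph α} {b c : Bool} {u v w : α}

theorem refl (G : SimpleGraph α) (u : α) : G.ParityReachable false u u := ⟨.nil, by simp⟩

theorem of_adj (h : G.Adj u v) : G.ParityReachable true u v := ⟨.cons h .nil, by simp⟩

theorem symm (h : G.ParityReachable b u v) : G.ParityReachable b v u := by
  obtain ⟨p, hp⟩ := h
  exact ⟨p.reverse, by simpa using hp⟩

theorem trans (h : G.ParityReachable b u v) (h' : G.ParityReachable c v w) :
    G.ParityReachable (b ^^ c) u w := by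
  obtain ⟨p, rfl⟩ := h
  obtain ⟨q, rfl⟩ := h'
  exact ⟨p.append q, by simp [Nat.bodd_add]⟩

theorem mono (hGH : G ≤ H) (h : G.ParityReachable b u v) : H.ParityReachable b u v := by
  obtain ⟨p, rfl⟩ := h
  exact ⟨p.mapLe hGH, by simp⟩

theorem reachable (h : G.ParityReachable b u v) : G.Reachable u v := ⟨h.choose⟩

end ParityReachable

theorem Reachable.exists_parity {G : SimpleGraph α} {u v : α} (h : G.Reachable u v) :
    ∃ b, G.ParityReachable b u v := ⟨_, h.some, rfl⟩

theorem ParityReachable.eq_of_bip {G : SimpleGraph α} (hG : ∀ u, ¬ G.ParityReachable true u u)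
    {b c : Bool} {u v : α} (h : G.ParityReachable b u v) (h' : G.ParityReachable c u v) : b = c := by
  by_contra hne
  refine hG v ?_
  have := h.symm.trans h'
  rwa [show (b ^^ c) = true by revert hne; cases b <;> cases c <;> simp] at this

/-- A walk between two vertices of a walk. -/
theorem Walk.exists_segment {G : SimpleGraph α} {u v : α} (p : G.Walk u v) {i j : ℕ} (hij : i ≤ j)
    (hj : j ≤ p.length) : ∃ q : G.Walk (p.getVert i) (p.getVert j), q.length = j - i := by
  induction j, hij using Nat.le_induction with
  | base => exact ⟨.nil, by simp⟩
  | succ j hij ih =>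
    obtain ⟨q, hq⟩ := ih (by omega)
    exact ⟨q.append (.cons (p.adj_getVert_succ (by omega)) .nil), by simp [hq]; omega⟩

/-- A shortest odd closed walk has no repeated vertices and no chords. -/
theorem exists_chordless_odd_closed_walk {G : SimpleGraph α} {u : α}
    (h : G.ParityReachable true u u) :
    ∃ (n : ℕ) (a : ℕ → α), 3 ≤ n ∧ Odd n ∧ a n = a 0 ∧ (∀ i < n, G.Adj (a i) (a (i + 1))) ∧
      (∀ i j, i < j → j < n → a i ≠ a j) ∧
      ∀ i j, i < j → j < n → G.Adj (a i) (a j) → j = i + 1 ∨ (i = 0 ∧ j + 1 = n) := by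
  classical
  have hex : ∃ n, Odd n ∧ ∃ (v : α) (p : G.Walk v v), p.length = n := by
    obtain ⟨p, hp⟩ := h
    refine ⟨p.length, ?_, u, p, rfl⟩
    rw [← Nat.not_even_iff_odd, Nat.even_iff, Nat.mod_two_of_bodd, hp]; simp
  obtain ⟨hodd, v, p, hp⟩ := Nat.find_spec hex
  set n := Nat.find hex with hn
  have hmin : ∀ m < n, Odd m → ∀ (v : α) (p : G.Walk v v), p.length ≠ m :=
    fun m hm hm' v p hpm => Nat.find_min hex hm ⟨hm', v, p, hpm⟩
  have h0n : p.getVert n = p.getVert 0 := by rw [← hp]; simp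
  have hinj : ∀ i j, i < j → j < n → p.getVert i ≠ p.getVert j := by
    intro i j hij hj heq
    obtain ⟨q, hq⟩ := p.exists_segment hij.le (by omega)
    obtain ⟨q₁, hq₁⟩ := p.exists_segment (Nat.zero_le i) (by omega)
    obtain ⟨q₂, hq₂⟩ := p.exists_segment hj.le (by omega)
    -- A repeated vertex splits the closed walk into two shorter closed walks, one of which is odd.
    rcases Nat.even_or_odd (j - i) with he | ho
    · refine hmin (i + (n - j)) (by omega) ?_ _
        ((q₁.append (q₂.copy heq.symm rfl)).copy rfl h0n) (by simp [hq₁, hq₂])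
      grind
    · exact hmin (j - i) (by omega) ho _ (q.copy rfl heq.symm) (by simpa using hq)
  have hch : ∀ i j, i < j → j < n → G.Adj (p.getVert i) (p.getVert j) →
      j = i + 1 ∨ (i = 0 ∧ j + 1 = n) := by
    intro i j hij hj hadj
    by_contra! hcon
    obtain ⟨q, hq⟩ := p.exists_segment hij.le (by omega)
    obtain ⟨q₁, hq₁⟩ := p.exists_segment (Nat.zero_le i) (by omega)
    obtain ⟨q₂, hq₂⟩ := p.exists_segment hj.le (by omega)
    -- The chord closes both arcs. Exactly one of the resulting closed walks is odd, and it is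
    -- shorter than `n` unless the chord is an edge of the walk.
    rcases Nat.even_or_odd (j - i) with he | ho
    · refine hmin (j - i + 1) (by omega) ?_ _ (q.append (.cons hadj.symm .nil)) (by simp [hq])
      grind
    · refine hmin (i + 1 + (n - j)) (by omega) ?_ _
        ((q₁.append (.cons hadj q₂)).copy rfl h0n) (by simp [hq₁, hq₂]; omega)
      grind
  have h3 : 3 ≤ n := by
    by_contra! hlt
    have h1 : n = 1 := by grind
    have := p.adj_getVert_succ (i := 0) (by omega)
    rw [zero_add, ← h1, h0n] at this
    exact this.ne rfl
  exact ⟨n, p.getVert, h3, hodd, h0n, fun i hi => p.adj_getVert_succ (by omega), hinj, hch⟩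

end SimpleGraph

/-! ### Minors given by deleted and kept sets, and blockers. -/

namespace Clutter

variable {α : Type*}

theorem ext_of {𝒞 𝒟 : Clutter α} (hg : 𝒞.ground = 𝒟.ground)
    (hm : ∀ C, C ∈ 𝒞.members ↔ C ∈ 𝒟.members) : 𝒞 = 𝒟 := by
  cases 𝒞; cases 𝒟
  obtain rfl := hg
  obtain rfl := Finset.ext hm
  rfl

/-- An antichain is determined by the upward closed family it generates, so minors and blockers can
be compared through that family. -/
theorem mem_iff_minimal {ℳ : Clutter α} {D : Finset α} :
    D ∈ ℳ.members ↔ Minimal (fun D => ∃ E ∈ ℳ.members, E ⊆ D) D := by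
  constructor
  · refine fun h => ⟨⟨D, h, subset_rfl⟩, ?_⟩
    rintro F ⟨E, hE, hEF⟩ hFD
    rw [← ℳ.antichain E hE D h (hEF.trans hFD)]
    exact hEF
  · rintro h
    obtain ⟨E, hE, hED⟩ := h.prop
    rwa [← h.eq_of_le ⟨E, hE, subset_rfl⟩ hED]

variable [DecidableEq α]

/-- `B` meets every member. -/
def Hits (𝒞 : Clutter α) (B : Finset α) : Prop := ∀ C ∈ 𝒞.members, (B ∩ C).Nonempty

theorem Hits.mono {𝒞 : Clutter α} {A B : Finset α} (h : 𝒞.Hits A) (hAB : A ⊆ B) : 𝒞.Hits B :=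
  fun C hC => (h C hC).mono (Finset.inter_subset_inter_right hAB)

theorem not_hits_iff {𝒞 : Clutter α} {B : Finset α} :
    ¬ 𝒞.Hits B ↔ ∃ C ∈ 𝒞.members, Disjoint B C := by
  simp [Hits, Finset.not_nonempty_iff_eq_empty, Finset.disjoint_iff_inter_eq_empty]

theorem mem_minor {𝒞 : Clutter α} {I J D : Finset α} :
    D ∈ (𝒞.minor I J).members ↔ Minimal (fun E => E ∈ 𝒞.minorFamily I J) D := by
  simp only [minor, Finset.mem_filter, and_iff_right_iff_imp]
  exact fun h => h.prop

theorem exists_member_subset_of_mem_minorFamily {𝒞 : Clutter α} {I J E : Finset α}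
    (hE : E ∈ 𝒞.minorFamily I J) : ∃ D ∈ (𝒞.minor I J).members, D ⊆ E := by
  classical
  obtain ⟨D, hDE, hD⟩ := exists_minimal_le_of_wellFoundedLT (fun E => E ∈ 𝒞.minorFamily I J) E hE
  exact ⟨D, mem_minor.2 hD, hDE⟩

section minor

variable {𝒞 : Clutter α} {I R : Finset α}

theorem minor_ground (hI : I ⊆ 𝒞.ground) (hR : R ⊆ 𝒞.ground) (hIR : Disjoint I R) :
    (𝒞.minor I (𝒞.ground \ (I ∪ R))).ground = R := by
  ext v
  have h1 : v ∈ I → v ∈ 𝒞.ground := fun h => hI h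
  have h2 : v ∈ R → v ∈ 𝒞.ground := fun h => hR h
  have h3 : v ∈ I → v ∉ R := fun h => Finset.disjoint_left.1 hIR h
  simp only [minor, Finset.mem_sdiff, Finset.mem_union]
  tauto

theorem isMinor_minor (hI : I ⊆ 𝒞.ground) :
    (𝒞.minor I (𝒞.ground \ (I ∪ R))).IsMinor 𝒞 :=
  ⟨I, _, hI, Finset.sdiff_subset,
    Finset.disjoint_left.2 fun v hv hv' => (Finset.mem_sdiff.1 hv').2 (by simp [hv]), rfl⟩

theorem exists_minorFamily_subset_iff {D : Finset α} :
    (∃ E ∈ 𝒞.minorFamily I (𝒞.ground \ (I ∪ R)), E ⊆ D) ↔ ¬ 𝒞.Hits (I ∪ (R \ D)) := by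
  rw [not_hits_iff]
  constructor
  · rintro ⟨E, hE, hED⟩
    obtain ⟨C, hC, rfl⟩ := Finset.mem_image.1 hE
    obtain ⟨hC, hCI⟩ := Finset.mem_filter.1 hC
    refine ⟨C, hC, Finset.disjoint_left.2 fun v hv hvC => ?_⟩
    have h1 := Finset.disjoint_left.1 hCI hvC
    have h2 := @hED v
    simp only [Finset.mem_union, Finset.mem_sdiff] at hv h2
    tauto
  · rintro ⟨C, hC, hdis⟩
    refine ⟨C \ (𝒞.ground \ (I ∪ R)), Finset.mem_image_of_mem _ (Finset.mem_filter.2 ⟨hC, ?_⟩), ?_⟩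
    · exact (Finset.disjoint_of_subset_left Finset.subset_union_left hdis).symm
    · intro v hv
      have h1 := 𝒞.subset_ground C hC (Finset.mem_sdiff.1 hv).1
      have h2 := Finset.disjoint_right.1 hdis (Finset.mem_sdiff.1 hv).1
      simp only [Finset.mem_union, Finset.mem_sdiff] at hv h2
      tauto

/-- This translates minors into `Hits` in the original clutter, with `I` deleted, `R` kept and
everything else contracted; all later arguments are phrased that way. -/
theorem exists_minor_member_subset_iff {D : Finset α} :
    (∃ E ∈ (𝒞.minor I (𝒞.ground \ (I ∪ R))).members, E ⊆ D) ↔ ¬ 𝒞.Hits (I ∪ (R \ D)) := by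
  rw [← exists_minorFamily_subset_iff]
  constructor
  · rintro ⟨E, hE, hED⟩
    exact ⟨E, (mem_minor.1 hE).prop, hED⟩
  · rintro ⟨E, hE, hED⟩
    obtain ⟨F, hF, hFE⟩ := exists_member_subset_of_mem_minorFamily hE
    exact ⟨F, hF, hFE.trans hED⟩

theorem mem_minor_iff (hI : I ⊆ 𝒞.ground) (hR : R ⊆ 𝒞.ground) (hIR : Disjoint I R)
    {D : Finset α} : D ∈ (𝒞.minor I (𝒞.ground \ (I ∪ R))).members ↔
      Minimal (fun D => D ⊆ R ∧ ¬ 𝒞.Hits (I ∪ (R \ D))) D := by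
  have hgr := minor_ground hI hR hIR
  rw [mem_iff_minimal]
  constructor
  · intro h
    have hDR : D ⊆ R := by
      have := mem_iff_minimal.2 h
      rw [← hgr]
      exact Clutter.subset_ground _ D this
    refine ⟨⟨hDR, exists_minor_member_subset_iff.1 h.prop⟩, fun F hF hFD => ?_⟩
    exact h.le_of_le (exists_minor_member_subset_iff.2 hF.2) hFD
  · intro h
    refine ⟨exists_minor_member_subset_iff.2 h.prop.2, fun F hF hFD => ?_⟩
    have hFR : F ⊆ R := hFD.trans h.prop.1
    exact h.le_of_le ⟨hFR, exists_minor_member_subset_iff.1 hF⟩ hFD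

theorem isCover_minor_iff (hI : I ⊆ 𝒞.ground) (hR : R ⊆ 𝒞.ground) (hIR : Disjoint I R)
    {B : Finset α} : (𝒞.minor I (𝒞.ground \ (I ∪ R))).IsCover B ↔ B ⊆ R ∧ 𝒞.Hits (I ∪ B) := by
  rw [IsCover, minor_ground hI hR hIR]
  refine and_congr_right fun hB => ?_
  have h := exists_minor_member_subset_iff (𝒞 := 𝒞) (I := I) (R := R) (D := R \ B)
  rw [Finset.sdiff_sdiff_eq_self hB, ← not_iff_not, not_not] at h
  rw [← h]
  push Not
  refine forall₂_congr fun D hD => ?_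
  have hDR : D ⊆ R := by
    have := Clutter.subset_ground _ D hD
    rwa [minor_ground hI hR hIR] at this
  constructor
  · rintro ⟨v, hv⟩ hcon
    have := hcon (Finset.mem_inter.1 hv).2
    exact (Finset.mem_sdiff.1 this).2 (Finset.mem_inter.1 hv).1
  · intro hns
    obtain ⟨v, hv, hv'⟩ := Finset.not_subset.1 hns
    exact ⟨v, Finset.mem_inter.2 ⟨by_contra fun hvB => hv' (Finset.mem_sdiff.2 ⟨hDR hv, hvB⟩), hv⟩⟩

end minor

theorem mem_blocker {ℳ : Clutter α} {B : Finset α} :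
    B ∈ ℳ.blocker.members ↔ Minimal ℳ.IsCover B := by
  simp only [blocker, Finset.mem_filter, Finset.mem_powerset, and_iff_right_iff_imp]
  exact fun h => h.prop.1

theorem isCover_blocker_iff {ℳ : Clutter α} {D : Finset α} :
    ℳ.blocker.IsCover D ↔ D ⊆ ℳ.ground ∧ ∃ C ∈ ℳ.members, C ⊆ D := by
  refine and_congr_right fun (hD : D ⊆ ℳ.ground) => ?_
  constructor
  · intro h
    by_contra! hcon
    have hcov : ℳ.IsCover (ℳ.ground \ D) := by
      refine ⟨Finset.sdiff_subset, fun C hC => ?_⟩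
      obtain ⟨v, hv, hv'⟩ := Finset.not_subset.1 (hcon C hC)
      exact ⟨v, by simp [hv, hv', ℳ.subset_ground C hC hv]⟩
    obtain ⟨B, hB, hBm⟩ := exists_minimal_le_of_wellFoundedLT ℳ.IsCover _ hcov
    obtain ⟨v, hv⟩ := h B (mem_blocker.2 hBm)
    rw [Finset.mem_inter] at hv
    exact (Finset.mem_sdiff.1 (hB hv.2)).2 hv.1
  · rintro ⟨C, hC, hCD⟩ B hB
    obtain ⟨v, hv⟩ := (mem_blocker.1 hB).prop.2 C hC
    rw [Finset.mem_inter] at hv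
    exact ⟨v, Finset.mem_inter.2 ⟨hCD hv.2, hv.1⟩⟩

theorem blocker_blocker (ℳ : Clutter α) : ℳ.blocker.blocker = ℳ := by
  refine ext_of rfl fun D => ?_
  rw [mem_blocker, mem_iff_minimal]
  constructor
  · intro h
    refine ⟨(isCover_blocker_iff.1 h.prop).2, fun F hF hFD => ?_⟩
    exact h.le_of_le (isCover_blocker_iff.2 ⟨(Finset.Subset.trans hFD h.prop.1), hF⟩) hFD
  · intro h
    refine ⟨isCover_blocker_iff.2 ⟨?_, h.prop⟩, fun F hF hFD =>
      h.le_of_le (isCover_blocker_iff.1 hF).2 hFD⟩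
    exact ℳ.subset_ground D (mem_iff_minimal.2 h)

/-- The pairs of remaining elements that, with the deleted set `I`, meet every member. -/
def pairGraph (𝒞 : Clutter α) (I R : Finset α) : SimpleGraph α where
  Adj u v := u ≠ v ∧ u ∈ R ∧ v ∈ R ∧ 𝒞.Hits (I ∪ {u, v})
  symm := ⟨fun u v h => ⟨h.1.symm, h.2.2.1, h.2.1, by rw [Finset.pair_comm]; exact h.2.2.2⟩⟩
  loopless := ⟨fun _ h => h.1 rfl⟩

theorem pairGraph_mono {𝒞 : Clutter α} {I I' R R' : Finset α} (hI : I ⊆ I') (hR : R ⊆ R') :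
    𝒞.pairGraph I R ≤ 𝒞.pairGraph I' R' :=
  fun _ _ h => ⟨h.1, hR h.2.1, hR h.2.2.1, h.2.2.2.mono (Finset.union_subset_union_left hI)⟩

/-- The minor obtained by deleting `I` and keeping `R` has covering number at least two. -/
structure Loose (𝒞 : Clutter α) (I R : Finset α) : Prop where
  sub_left : I ⊆ 𝒞.ground
  sub_right : R ⊆ 𝒞.ground
  disj : Disjoint I R
  not_hits : ¬ 𝒞.Hits I
  not_hits_insert : ∀ x ∈ R, ¬ 𝒞.Hits (I ∪ {x})

theorem Loose.mono {𝒞 : Clutter α} {I R R' : Finset α} (h : 𝒞.Loose I R) (hR : R' ⊆ R) :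
    𝒞.Loose I R' :=
  ⟨h.1, hR.trans h.2, Finset.disjoint_of_subset_right hR h.3, h.4, fun x hx => h.5 x (hR hx)⟩

end Clutter

/-! ### Excluded minors: common neighbours and bipartiteness of the pair graph. -/

namespace Clutter

variable {α : Type*} [DecidableEq α]

theorem Loose.not_hits_of_card_le_one {𝒞 : Clutter α} {I R N : Finset α} (h : 𝒞.Loose I R)
    (hN : N ⊆ R) (hc : N.card ≤ 1) : ¬ 𝒞.Hits (I ∪ N) := by
  rcases Finset.eq_empty_or_nonempty N with rfl | hne
  · simpa using h.not_hits
  · obtain ⟨x, rfl⟩ := Finset.card_eq_one.1 (le_antisymm hc hne.card_pos)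
    exact h.not_hits_insert x (hN (by simp))

/-- An enumeration of `S` by the indices `2, …, |S| + 1`, preceded by `u`. -/
theorem exists_enum_cons (u : α) (S : Finset α) (hu : u ∉ S) :
    ∃ a : ℕ → α, a 1 = u ∧ Set.InjOn a (Set.Icc 1 (S.card + 1)) ∧
      (Finset.Icc 2 (S.card + 1)).image a = S := by
  induction S using Finset.induction_on with
  | empty => exact ⟨fun _ => u, rfl, by simp, by simp⟩
  | insert x S hx ih =>
    obtain ⟨a, ha1, hinj, him⟩ := ih fun h => hu (Finset.mem_insert_of_mem h)
    have hmem : ∀ i, 1 ≤ i → i ≤ S.card + 1 → a i ≠ x := by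
      rintro i hi hi' rfl
      rcases hi.eq_or_lt with rfl | hlt
      · exact hu (by simp [ha1])
      · exact hx (him ▸ Finset.mem_image_of_mem a (Finset.mem_Icc.2 ⟨hlt, hi'⟩))
    refine ⟨Function.update a (S.card + 2) x, ?_, ?_, ?_⟩
    · simp [ha1]
    · rw [Finset.card_insert_of_notMem hx]
      intro i hi j hj hij
      simp only [Set.mem_Icc] at hi hj
      by_cases hi' : i = S.card + 2 <;> by_cases hj' : j = S.card + 2
      · omega
      · rw [hi', Function.update_self, Function.update_of_ne hj'] at hij
        exact absurd hij.symm (hmem j hj.1 (by omega))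
      · rw [hj', Function.update_self, Function.update_of_ne hi'] at hij
        exact absurd hij (hmem i hi.1 (by omega))
      · rw [Function.update_of_ne hi', Function.update_of_ne hj'] at hij
        exact hinj ⟨hi.1, by omega⟩ ⟨hj.1, by omega⟩ hij
    · rw [Finset.card_insert_of_notMem hx,
        show Finset.Icc 2 (S.card + 1 + 1) = insert (S.card + 2) (Finset.Icc 2 (S.card + 1)) by
          ext i; simp; omega, Finset.image_insert, Function.update_self]
      congr 1
      conv_rhs => rw [← him]
      refine Finset.image_congr fun i hi => Function.update_of_ne ?_ _ _
      simp at hi; omega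

variable {𝒞 : Clutter α} {I R : Finset α}

/-- In a clean clutter, a minimal set of remaining elements meeting every member contains a common
neighbour of any two of its elements. -/
theorem IsClean.common_neighbor_mem (hclean : 𝒞.IsClean) (hl : 𝒞.Loose I R) {M : Finset α}
    (hMR : M ⊆ R) (hit : 𝒞.Hits (I ∪ M)) (hmin : ∀ N ⊂ M, ¬ 𝒞.Hits (I ∪ N)) {u v w : α}
    (hv : v ∈ M) (hw : w ∈ M) (hvw : v ≠ w) (huv : (𝒞.pairGraph I R).Adj u v)
    (huw : (𝒞.pairGraph I R).Adj u w) : u ∈ M := by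
  classical
  by_contra huM
  have huR : u ∈ R := huv.2.1
  -- `K` is a largest part of `M` that can be deleted with `I` before `u` becomes a cover by itself.
  -- Afterwards the minimal covers inside `{u} ∪ (M \ K)` are `M \ K` and the pairs `{u, z}` with `z
  -- ∈ M \ K`. A delta is its own blocker, so the minor is a delta with centre `u`.
  obtain ⟨K, hK, hKmax⟩ := Finset.exists_max_image
    (M.powerset.filter fun K => ¬ 𝒞.Hits (I ∪ K ∪ {u})) Finset.card
    ⟨∅, by simpa using hl.not_hits_insert u huR⟩
  simp only [Finset.mem_filter, Finset.mem_powerset] at hK hKmax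
  obtain ⟨hKM, hKu⟩ := hK
  have hmax : ∀ z ∈ M, z ∉ K → 𝒞.Hits (I ∪ insert z K ∪ {u}) := by
    intro z hz hzK
    by_contra hcon
    have := hKmax (insert z K) ⟨Finset.insert_subset hz hKM, hcon⟩
    rw [Finset.card_insert_of_notMem hzK] at this
    omega
  -- Neighbours of `u` survive in `M \ K`; the two elements `v`, `w` give the delta its required
  -- size of at least three.
  have hnotK : ∀ z, (𝒞.pairGraph I R).Adj u z → z ∉ K := by
    intro z hz hzK
    refine hKu (hz.2.2.2.mono ?_)
    grind
  set S := M \ K with hS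
  have huS : u ∉ S := by simp [hS, huM]
  have hvS : v ∈ S := by simp [hS, hv, hnotK v huv]
  have hwS : w ∈ S := by simp [hS, hw, hnotK w huw]
  have hI' : I ∪ K ⊆ 𝒞.ground :=
    Finset.union_subset hl.sub_left (hKM.trans (hMR.trans hl.sub_right))
  have hR' : insert u S ⊆ 𝒞.ground := by
    refine Finset.insert_subset (hl.sub_right huR) ?_
    exact Finset.sdiff_subset.trans (hMR.trans hl.sub_right)
  have hdis : Disjoint (I ∪ K) (insert u S) := by
    have := Finset.disjoint_left.1 hl.disj
    rw [Finset.disjoint_left]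
    intro x hx hx'
    grind
  have hP : ∀ D ⊆ insert u S, (¬ 𝒞.Hits (I ∪ K ∪ (insert u S \ D)) ↔
      S ⊆ D ∨ (u ∈ D ∧ ∃ z ∈ S, z ∈ D)) := by
    intro D hD
    constructor
    · intro h
      by_contra! hcon
      by_cases huD : u ∈ D
      · refine h (hit.mono ?_)
        have := hcon.2 huD
        grind
      · obtain ⟨z, hz, hzD⟩ := Finset.not_subset.1 hcon.1
        refine h ((hmax z (by grind) (by grind)).mono ?_)
        grind
    · rintro (h | ⟨huD, z, hz, hzD⟩) hh
      · refine hKu (hh.mono ?_)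
        grind
      · refine hmin (M.erase z) (Finset.erase_ssubset (by grind)) (hh.mono ?_)
        grind
  obtain ⟨a, ha1, hinj, him⟩ := exists_enum_cons u S huS
  have hcard : 2 ≤ S.card := by
    have := Finset.card_le_card (show {v, w} ⊆ S by grind)
    rwa [Finset.card_pair hvw] at this
  refine (hclean _ (isMinor_minor (R := insert u S) hI')).1
    ⟨S.card + 1, a, by omega, hinj, ?_, ?_⟩
  · rw [minor_ground hI' hR' hdis, show Finset.Icc 1 (S.card + 1)
      = insert 1 (Finset.Icc 2 (S.card + 1)) by ext i; simp; omega, Finset.image_insert, him, ha1]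
  · have himg : (Finset.Icc 2 (S.card + 1)).image (fun i => ({a 1, a i} : Finset α)) =
        S.image fun z => {u, z} := by
      conv_rhs => rw [← him]
      rw [Finset.image_image, ha1]; rfl
    rw [himg, him]
    ext D
    rw [mem_minor_iff hI' hR' hdis, Finset.mem_insert, Finset.mem_image]
    constructor
    · intro hD
      rcases (hP D hD.prop.1).1 hD.prop.2 with h | ⟨huD, z, hz, hzD⟩
      · exact .inl (hD.eq_of_le ⟨Finset.subset_insert u S, (hP S (Finset.subset_insert u S)).2
          (.inl subset_rfl)⟩ h).symm
      · refine .inr ⟨z, hz, ?_⟩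
        have hs : {u, z} ⊆ insert u S :=
          Finset.insert_subset_insert u (Finset.singleton_subset_iff.2 hz)
        exact hD.eq_of_le ⟨hs, (hP _ hs).2 (.inr ⟨by simp, z, hz, by simp⟩)⟩
          (Finset.insert_subset huD (Finset.singleton_subset_iff.2 hzD))
    · rintro (rfl | ⟨z, hz, rfl⟩)
      · refine ⟨⟨Finset.subset_insert u _, (hP _ (Finset.subset_insert u _)).2
          (.inl subset_rfl)⟩, fun F hF hFS => ?_⟩
        rcases (hP F hF.1).1 hF.2 with h | ⟨huF, -⟩
        · exact h
        · exact absurd (hFS huF) huS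
      · have hs : {u, z} ⊆ insert u S :=
          Finset.insert_subset_insert u (Finset.singleton_subset_iff.2 hz)
        refine ⟨⟨hs, (hP _ hs).2 (.inr ⟨by simp, z, hz, by simp⟩)⟩, fun F hF hFS => ?_⟩
        have hFS' : F ⊆ {u, z} := hFS
        show {u, z} ⊆ F
        rcases (hP F hF.1).1 hF.2 with h | ⟨huF, y, hy, hyF⟩
        · have h1 := hFS' (h hvS)
          have h2 := hFS' (h hwS)
          simp only [Finset.mem_insert, Finset.mem_singleton] at h1 h2
          exact absurd ((h1.resolve_left fun e => huS (e ▸ hvS)).trans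
            (h2.resolve_left fun e => huS (e ▸ hwS)).symm) hvw
        · have h1 := hFS' hyF
          simp only [Finset.mem_insert, Finset.mem_singleton] at h1
          obtain rfl := h1.resolve_left fun e => huS (e ▸ hy)
          exact Finset.insert_subset huF (Finset.singleton_subset_iff.2 hyF)

/-- In a clean clutter, the pair graph of a minor with covering number at least two has no odd
closed walk. -/
theorem IsClean.not_odd (hclean : 𝒞.IsClean) (hl : 𝒞.Loose I R) (u : α) :
    ¬ (𝒞.pairGraph I R).ParityReachable true u u := by
  intro hodd
  obtain ⟨n, a, hn, hnodd, han, hadj, hinj, hch⟩ :=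
    SimpleGraph.exists_chordless_odd_closed_walk hodd
  have haR : ∀ i ≤ n, a i ∈ R := by
    intro i hi
    rcases hi.eq_or_lt with rfl | hlt
    · rw [han]; exact (hadj 0 (by omega)).2.1
    · exact (hadj i hlt).2.1
  -- Triangles are not extended odd holes; they are excluded through a delta, by
  -- `common_neighbor_mem` applied to one edge and the opposite vertex.
  rcases hn.eq_or_lt with rfl | hlt
  · have h12 := hadj 1 (by omega)
    have h01 := hadj 0 (by omega)
    have h20 := hadj 2 (by omega)
    simp only [Nat.reduceAdd, han] at h12 h01 h20
    have := hclean.common_neighbor_mem hl (M := {a 1, a 2}) (u := a 0) (v := a 1) (w := a 2)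
      (by have := haR 1; have := haR 2; grind) h12.2.2.2 (fun N hN => ?_) (by simp) (by simp)
      h12.1 h01 h20.symm
    · have h1 := h01.1
      have h2 := h20.1
      simp at this
      grind
    · refine hl.not_hits_of_card_le_one (hN.subset.trans (by have := haR 1; have := haR 2; grind)) ?_
      have := Finset.card_lt_card hN
      rw [Finset.card_pair h12.1] at this
      omega
  have hn5 : 5 ≤ n := by grind
  set R' := (Finset.Icc 1 n).image a with hR'
  have hRR : R' ⊆ R := by
    intro x hx
    obtain ⟨i, hi, rfl⟩ := Finset.mem_image.1 hx
    exact haR i (Finset.mem_Icc.1 hi).2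
  have hl' : 𝒞.Loose I R' := hl.mono hRR
  have hg := minor_ground hl'.sub_left hl'.sub_right hl'.disj
  have hcov := fun B => isCover_minor_iff (B := B) hl'.sub_left hl'.sub_right hl'.disj
  set ℳ := 𝒞.minor I (𝒞.ground \ (I ∪ R')) with hℳ
  have hzero : ∀ x ∈ R', ∃ i < n, a i = x := by
    intro x hx
    obtain ⟨i, hi, rfl⟩ := Finset.mem_image.1 hx
    rw [Finset.mem_Icc] at hi
    rcases hi.2.eq_or_lt with rfl | hlt
    · exact ⟨0, by omega, han.symm⟩
    · exact ⟨i, hlt, rfl⟩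
  set 𝓔 : Finset (Finset α) :=
    insert {a n, a 1} ((Finset.Ico 1 n).image fun i => {a i, a (i + 1)}) with h𝓔
  have hR'mem : ∀ i, 1 ≤ i → i ≤ n → a i ∈ R' := fun i h1 h2 =>
    Finset.mem_image_of_mem a (Finset.mem_Icc.2 ⟨h1, h2⟩)
  have hedge : ∀ B ∈ 𝓔, ℳ.IsCover B ∧ B.card = 2 := by
    intro B hB
    rcases Finset.mem_insert.1 hB with rfl | hB
    · rw [hcov]
      have h01 := hadj 0 (by omega)
      have h1 := hR'mem n (by omega) le_rfl
      have h2 := hR'mem 1 le_rfl (by omega)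
      rw [han] at h1 ⊢
      refine ⟨⟨by grind, h01.2.2.2⟩, Finset.card_pair h01.1⟩
    · obtain ⟨i, hi, rfl⟩ := Finset.mem_image.1 hB
      rw [Finset.mem_Ico] at hi
      have h := hadj i hi.2
      have h1 := hR'mem i hi.1 hi.2.le
      have h2 := hR'mem (i + 1) (by omega) (by omega)
      exact ⟨(hcov _).2 ⟨by grind, h.2.2.2⟩, Finset.card_pair h.1⟩
  have hcard : ∀ B, ℳ.IsCover B → 2 ≤ B.card := by
    intro B hB
    by_contra! hlt
    rw [hcov] at hB
    exact hl'.not_hits_of_card_le_one hB.1 (by omega) hB.2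
  have hpair : ∀ i j, i < j → j < n → 𝒞.Hits (I ∪ {a i, a j}) → {a i, a j} ∈ 𝓔 := by
    intro i j hij hj hit
    rcases hch i j hij hj ⟨hinj i j hij hj, haR i (by omega), haR j hj.le, hit⟩ with rfl | ⟨rfl, h⟩
    · rcases Nat.eq_zero_or_pos i with rfl | hi
      · rw [← han]; exact Finset.mem_insert_self _ _
      · exact Finset.mem_insert_of_mem (Finset.mem_image_of_mem
          (fun i => ({a i, a (i + 1)} : Finset α)) (Finset.mem_Ico.2 ⟨hi, by omega⟩))
    · refine Finset.mem_insert_of_mem (Finset.mem_image.2 ⟨j, Finset.mem_Ico.2 ⟨by omega, hj⟩, ?_⟩)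
      rw [h, han, Finset.pair_comm]
  have hmin2 : ∀ B, ℳ.IsCover B → B.card = 2 → Minimal ℳ.IsCover B := by
    refine fun B hB hB2 => ⟨hB, fun F hF hFB => ?_⟩
    rw [Finset.eq_of_subset_of_card_le hFB (by rw [hB2]; exact hcard F hF)]
  -- Since the cycle has no chords, its edges are exactly the minimum covers of the minor. So the
  -- blocker of the minor is an extended odd hole, and the minor is the blocker of that.
  refine (hclean ℳ (isMinor_minor hl'.sub_left)).2 ⟨ℳ.blocker, ⟨n, a, hn5, hnodd, ?_, hg, ?_⟩,
    (blocker_blocker ℳ).symm⟩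
  · intro i hi j hj hij
    simp only [Set.mem_Icc] at hi hj
    have key : ∀ i j, 1 ≤ i → i < j → j ≤ n → a i ≠ a j := by
      intro i j hi hij hj
      rcases hj.eq_or_lt with rfl | hlt
      · rw [han]; exact (hinj 0 i (by omega) hij).symm
      · exact hinj i j hij hlt
    rcases lt_trichotomy i j with h | h | h
    · exact absurd hij (key i j hi.1 h hj.2)
    · exact h
    · exact absurd hij.symm (key j i hj.1 h hi.2)
  · ext B
    rw [minMembers, Finset.mem_filter, mem_blocker]
    constructor
    · rintro ⟨hB, hBmin⟩
      have h0 : ({a n, a 1} : Finset α) ∈ 𝓔 := Finset.mem_insert_self _ _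
      have h2 := hBmin _ (mem_blocker.2 (hmin2 _ (hedge _ h0).1 (hedge _ h0).2))
      rw [(hedge _ h0).2] at h2
      obtain ⟨x, y, hxy, rfl⟩ := Finset.card_eq_two.1 (le_antisymm h2 (hcard B hB.prop))
      have hc := (hcov _).1 hB.prop
      obtain ⟨i, hi, rfl⟩ := hzero x (hc.1 (by simp))
      obtain ⟨j, hj, rfl⟩ := hzero y (hc.1 (by simp))
      rcases lt_trichotomy i j with h | h | h
      · exact hpair i j h hj hc.2
      · exact absurd (by rw [h]) hxy
      · have hc2 := hc.2
        rw [Finset.pair_comm (a i) (a j)] at hc2 ⊢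
        exact hpair j i h hi hc2
    · intro hB
      refine ⟨hmin2 B (hedge B hB).1 (hedge B hB).2, fun D hD => ?_⟩
      rw [(hedge B hB).2]
      exact hcard D (mem_blocker.1 hD).prop

end Clutter

/-! ### Even sets are not covers, and sides of components can be deleted. -/

namespace Clutter

variable {α : Type*} [DecidableEq α] {𝒞 : Clutter α} {I I' R R' : Finset α}

theorem parityReachable_of_support_subset {u v : α} (p : (𝒞.pairGraph I R).Walk u v) (hI : I ⊆ I')
    (hp : ∀ x ∈ p.support, x ∈ R') : (𝒞.pairGraph I' R').ParityReachable p.length.bodd u v := by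
  induction p with
  | nil => simpa using .refl _ _
  | @cons u v w h p ih =>
    have h1 : (𝒞.pairGraph I' R').Adj u v :=
      ⟨h.1, hp u (by simp), hp v (by simp), h.2.2.2.mono (Finset.union_subset_union_left hI)⟩
    simpa [Nat.bodd_add] using
      (SimpleGraph.ParityReachable.of_adj h1).trans (ih fun x hx => hp x (by simp [hx]))

theorem mem_of_mem_support {u v x : α} (p : (𝒞.pairGraph I R).Walk u v) (hu : u ∈ R)
    (hx : x ∈ p.support) : x ∈ R := by
  induction p with
  | nil => simpa using (List.mem_singleton.1 hx) ▸ hu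
  | cons h p ih =>
    rcases List.mem_cons.1 (by simpa using hx) with rfl | hx
    · exact hu
    · exact ih h.2.2.1 hx

theorem Loose.insert_left (hl : 𝒞.Loose I R) {k : α} (hk : k ∈ R) (hR' : R' ⊆ R) (hkR' : k ∉ R')
    (hadj : ∀ x ∈ R', ¬ (𝒞.pairGraph I R).Adj k x) : 𝒞.Loose (I ∪ {k}) R' where
  sub_left := Finset.union_subset hl.sub_left (Finset.singleton_subset_iff.2 (hl.sub_right hk))
  sub_right := hR'.trans hl.sub_right
  disj := by
    rw [Finset.disjoint_union_left, Finset.disjoint_singleton_left]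
    exact ⟨Finset.disjoint_of_subset_right hR' hl.disj, hkR'⟩
  not_hits := hl.not_hits_insert k hk
  not_hits_insert := by
    intro x hx hit
    refine hadj x hx ⟨fun h => hkR' (h ▸ hx), hk, hR' hx, hit.mono ?_⟩
    intro y; simp only [Finset.mem_union, Finset.mem_singleton, Finset.mem_insert]; tauto

/-- In a clean clutter, a set of remaining elements that are pairwise joined by even walks of the
pair graph does not meet every member avoiding the deleted set. -/
theorem IsClean.not_hits_of_even (hclean : 𝒞.IsClean) (hl : 𝒞.Loose I R) {M : Finset α}
    (hMR : M ⊆ R)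
    (hM : ∀ x ∈ M, ∀ y ∈ M, (𝒞.pairGraph I R).ParityReachable false x y) :
    ¬ 𝒞.Hits (I ∪ M) := by
  classical
  induction hn : M.card using Nat.strong_induction_on generalizing I R M with
  | _ n ih =>
  subst hn
  intro hit
  by_cases hmin : ∀ N ⊂ M, ¬ 𝒞.Hits (I ∪ N)
  swap
  · push Not at hmin
    obtain ⟨N, hN, hNit⟩ := hmin
    exact ih _ (Finset.card_lt_card hN) hl (hN.subset.trans hMR)
      (fun x hx y hy => hM x (hN.subset hx) y (hN.subset hy)) rfl hNit
  have hcard : 2 ≤ M.card := by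
    by_contra! hlt
    exact hl.not_hits_of_card_le_one hMR (by omega) hit
  rcases hcard.eq_or_lt with h2 | h3
  · obtain ⟨x, y, hxy, rfl⟩ := Finset.card_eq_two.1 h2.symm
    have hadj : (𝒞.pairGraph I R).Adj x y := ⟨hxy, hMR (by simp), hMR (by simp), hit⟩
    exact hclean.not_odd hl x (by
      simpa using (SimpleGraph.ParityReachable.of_adj hadj).trans (hM y (by simp) x (by simp)))
  have hstable : ∀ x ∈ M, ∀ y ∈ M, ¬ (𝒞.pairGraph I R).Adj x y := by
    intro x hx y hy hadj
    refine hmin {x, y} ?_ hadj.2.2.2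
    refine Finset.ssubset_iff_subset_ne.2 ⟨Finset.insert_subset hx
      (Finset.singleton_subset_iff.2 hy), ?_⟩
    rintro rfl
    have := Finset.card_le_two (a := x) (b := y)
    omega
  obtain ⟨r, hr⟩ : M.Nonempty := Finset.card_pos.1 (by omega)
  -- `k` is an element of `M` farthest from `r`. A shortest walk from `r` to another `m ∈ M` then
  -- avoids `k`. A neighbour of `k` on it would have to be `m`, against stability of `M`, or
  -- adjacent to `m`; in the latter case it lies in `M` by `common_neighbor_mem`, again against
  -- stability.
  obtain ⟨k, hk, hkmax⟩ := Finset.exists_max_image (M.erase r) ((𝒞.pairGraph I R).dist r)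
    (Finset.card_pos.1 (by rw [Finset.card_erase_of_mem hr]; omega))
  rw [Finset.mem_erase] at hk
  -- With `k` deleted, its neighbours are covers by themselves, so they are contracted. The walks
  -- from `r` survive and the induction applies to `M` without `k`.
  set R' := R.filter fun x => x ≠ k ∧ ¬ (𝒞.pairGraph I R).Adj k x with hR'
  have hl' : 𝒞.Loose (I ∪ {k}) R' := hl.insert_left (hMR hk.2) (Finset.filter_subset _ _)
    (by simp [hR']) (fun x hx => (Finset.mem_filter.1 hx).2.2)
  have heven : ∀ m ∈ M.erase k, (𝒞.pairGraph (I ∪ {k}) R').ParityReachable false r m := by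
    intro m hm
    rw [Finset.mem_erase] at hm
    obtain ⟨p, hp⟩ := (hM r hr m hm.2).reachable.exists_walk_length_eq_dist
    have hpar : p.length.bodd = false :=
      SimpleGraph.ParityReachable.eq_of_bip (hclean.not_odd hl) ⟨p, rfl⟩ (hM r hr m hm.2)
    rw [← hpar]
    refine parityReachable_of_support_subset p Finset.subset_union_left fun n hn => ?_
    have hkd : (𝒞.pairGraph I R).dist r m ≤ (𝒞.pairGraph I R).dist r k := by
      rcases eq_or_ne m r with rfl | hmr
      · simp
      · exact hkmax m (Finset.mem_erase.2 ⟨hmr, hm.2⟩)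
    have hlen : (p.takeUntil n hn).length + (p.dropUntil n hn).length = p.length := by
      rw [← SimpleGraph.Walk.length_append, SimpleGraph.Walk.take_spec]
    have hnR := mem_of_mem_support p (hMR hr) hn
    have hn1 : n = k → False := by
      rintro rfl
      have h1 := SimpleGraph.dist_le (p.takeUntil n hn)
      have h0 : (p.dropUntil n hn).length = 0 := by omega
      exact hm.1 (SimpleGraph.Walk.eq_of_length_eq_zero h0).symm
    refine Finset.mem_filter.2 ⟨hnR, hn1, fun hadj => ?_⟩
    have h1 := SimpleGraph.dist_le ((p.takeUntil n hn).append (.cons hadj.symm .nil))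
    rw [SimpleGraph.Walk.length_append] at h1
    simp only [SimpleGraph.Walk.length_cons, SimpleGraph.Walk.length_nil, zero_add] at h1
    have h0 : (p.dropUntil n hn).length ≤ 1 := by omega
    rcases Nat.le_one_iff_eq_zero_or_eq_one.1 h0 with h0 | h0
    · obtain rfl := SimpleGraph.Walk.eq_of_length_eq_zero h0
      exact hstable k hk.2 n hm.2 hadj
    · have hnm := SimpleGraph.Walk.adj_of_length_eq_one h0
      have hnM := hclean.common_neighbor_mem hl hMR hit hmin hk.2 hm.2 hm.1.symm hadj.symm hnm
      exact hstable n hnM m hm.2 hnm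
  have hsub : M.erase k ⊆ R' := by
    intro m hm
    rw [Finset.mem_erase] at hm
    exact Finset.mem_filter.2 ⟨hMR hm.2, hm.1, hstable k hk.2 m hm.2⟩
  refine ih _ (Finset.card_lt_card (Finset.erase_ssubset hk.2)) hl' hsub
    (fun x hx y hy => by simpa using (heven x hx).symm.trans (heven y hy)) rfl (hit.mono ?_)
  intro y hy
  simp only [Finset.mem_union, Finset.mem_singleton, Finset.mem_erase] at hy ⊢
  tauto

open Classical in
/-- The remaining elements reachable from `x` by a walk of parity `b`. -/
noncomputable def side (𝒞 : Clutter α) (I R : Finset α) (x : α) (b : Bool) : Finset α :=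
  R.filter ((𝒞.pairGraph I R).ParityReachable b x)

theorem mem_side {x y : α} {b : Bool} :
    y ∈ 𝒞.side I R x b ↔ y ∈ R ∧ (𝒞.pairGraph I R).ParityReachable b x y := by
  simp [side]

theorem side_subset {x : α} {b : Bool} : 𝒞.side I R x b ⊆ R := fun _ h => (mem_side.1 h).1

open Classical in
/-- The component of `x` in the pair graph. -/
noncomputable def comp (𝒞 : Clutter α) (I R : Finset α) (x : α) : Finset α :=
  R.filter ((𝒞.pairGraph I R).Reachable x)

theorem mem_comp {x y : α} :
    y ∈ 𝒞.comp I R x ↔ y ∈ R ∧ (𝒞.pairGraph I R).Reachable x y := by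
  simp [comp]

theorem side_subset_comp {x : α} {b : Bool} : 𝒞.side I R x b ⊆ 𝒞.comp I R x := fun _ h =>
  mem_comp.2 ⟨(mem_side.1 h).1, (mem_side.1 h).2.reachable⟩

theorem mem_comp_iff_exists_side {x y : α} :
    y ∈ 𝒞.comp I R x ↔ ∃ b, y ∈ 𝒞.side I R x b := by
  constructor
  · intro h
    obtain ⟨b, hb⟩ := (mem_comp.1 h).2.exists_parity
    exact ⟨b, mem_side.2 ⟨(mem_comp.1 h).1, hb⟩⟩
  · rintro ⟨b, hb⟩
    exact side_subset_comp hb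

/-- Deleting one side of a component of the pair graph and contracting the other side keeps the
covering number at least two. -/
theorem IsClean.loose_side (hclean : 𝒞.IsClean) (hl : 𝒞.Loose I R) {x : α} (hx : x ∈ R)
    (b : Bool) : 𝒞.Loose (I ∪ 𝒞.side I R x b) (R \ 𝒞.comp I R x) where
  sub_left := Finset.union_subset hl.sub_left (side_subset.trans hl.sub_right)
  sub_right := Finset.sdiff_subset.trans hl.sub_right
  disj := by
    rw [Finset.disjoint_union_left]
    exact ⟨Finset.disjoint_of_subset_right Finset.sdiff_subset hl.disj,
      Finset.disjoint_of_subset_left side_subset_comp Finset.disjoint_sdiff⟩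
  not_hits := by
    refine hclean.not_hits_of_even hl side_subset fun u hu v hv => ?_
    simpa using (mem_side.1 hu).2.symm.trans (mem_side.1 hv).2
  not_hits_insert := by
    classical
    intro y hy hit
    rw [Finset.mem_sdiff, mem_comp] at hy
    -- Deleting `y` and contracting its neighbours leaves the component of `x` untouched, as `y`
    -- lies outside it.
    set R' := R.filter fun z => z ≠ y ∧ ¬ (𝒞.pairGraph I R).Adj y z with hR'
    have hl' : 𝒞.Loose (I ∪ {y}) R' := hl.insert_left hy.1 (Finset.filter_subset _ _)
      (by simp [hR']) (fun x hx => (Finset.mem_filter.1 hx).2.2)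
    have hin : ∀ z ∈ R, (𝒞.pairGraph I R).Reachable x z → z ∈ R' := by
      refine fun z hz hxz => Finset.mem_filter.2 ⟨hz, ?_, fun hadj => ?_⟩
      · rintro rfl; exact hy.2 ⟨hz, hxz⟩
      · exact hy.2 ⟨hy.1, hxz.trans hadj.symm.reachable⟩
    have hpar : ∀ z ∈ 𝒞.side I R x b, (𝒞.pairGraph (I ∪ {y}) R').ParityReachable b x z := by
      intro z hz
      obtain ⟨p, rfl⟩ := (mem_side.1 hz).2
      exact parityReachable_of_support_subset p Finset.subset_union_left fun n hn =>
        hin n (mem_of_mem_support p hx hn) ⟨p.takeUntil n hn⟩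
    refine hclean.not_hits_of_even hl' (M := 𝒞.side I R x b)
      (fun z hz => hin z (mem_side.1 hz).1 (mem_side.1 hz).2.reachable)
      (fun u hu v hv => by simpa using (hpar u hu).symm.trans (hpar v hv)) (hit.mono ?_)
    intro z
    simp only [Finset.mem_union, Finset.mem_singleton]
    tauto

end Clutter

/-! ### Half packings: measures on members with all marginals one half. -/

namespace Clutter

variable {α : Type*} [DecidableEq α] {𝒞 : Clutter α} {I R : Finset α}

/-- Every remaining element has a neighbour in the pair graph. -/
def NoIsolated (𝒞 : Clutter α) (I R : Finset α) : Prop :=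
  ∀ x ∈ R, ∃ y, (𝒞.pairGraph I R).Adj x y

theorem NoIsolated.sdiff_comp (h : 𝒞.NoIsolated I R) (x : α) (b : Bool) :
    𝒞.NoIsolated (I ∪ 𝒞.side I R x b) (R \ 𝒞.comp I R x) := by
  intro y hy
  rw [Finset.mem_sdiff, mem_comp] at hy
  obtain ⟨z, hz⟩ := h y hy.1
  refine ⟨z, hz.1, Finset.mem_sdiff.2 ⟨hy.1, fun h => hy.2 (mem_comp.1 h)⟩, Finset.mem_sdiff.2 ⟨hz.2.2.1, fun hzc => ?_⟩,
    hz.2.2.2.mono (Finset.union_subset_union_left Finset.subset_union_left)⟩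
  exact hy.2 ⟨hy.1, (mem_comp.1 hzc).2.trans hz.symm.reachable⟩

/-- Every element of one side has a neighbour on the other. A member avoiding that neighbour and `I`
must contain the element. -/
theorem NoIsolated.side_subset_of_disjoint (h : 𝒞.NoIsolated I R) {x : α} {b : Bool}
    {C : Finset α} (hC : C ∈ 𝒞.members) (hdis : Disjoint (I ∪ 𝒞.side I R x b) C) :
    𝒞.side I R x (!b) ⊆ C := by
  intro z hz
  rw [mem_side] at hz
  obtain ⟨y, hy⟩ := h z hz.1
  have hyb : y ∈ 𝒞.side I R x b :=
    mem_side.2 ⟨hy.2.2.1, by simpa using hz.2.trans (.of_adj hy)⟩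
  obtain ⟨t, ht⟩ := hy.2.2.2 C hC
  simp only [Finset.mem_inter, Finset.mem_union, Finset.mem_insert, Finset.mem_singleton] at ht
  have hd := Finset.disjoint_right.1 hdis ht.2
  simp only [Finset.mem_union] at hd
  rcases ht.1 with h | rfl | rfl
  · exact absurd (.inl h) hd
  · exact ht.2
  · exact absurd (.inr hyb) hd

/-- Nonnegative weights of total one on the members avoiding `I` that give every element of `R`
weight one half. -/
structure IsHalfPacking (𝒞 : Clutter α) (I R : Finset α) (w : Finset α → ℝ) : Prop where
  nonneg : ∀ C, 0 ≤ w C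
  supp : ∀ C, w C ≠ 0 → C ∈ 𝒞.members ∧ Disjoint I C
  total : ∑ C ∈ 𝒞.members, w C = 1
  half : ∀ v ∈ R, ∑ C ∈ 𝒞.members, (if v ∈ C then w C else 0) = 1 / 2

namespace IsHalfPacking

variable {w w₀ w₁ : Finset α → ℝ}

theorem sum_eq_zero (h : 𝒞.IsHalfPacking I R w) {v : α} (hv : v ∈ I) (P : Finset α → Prop)
    [DecidablePred P] :
    ∑ C ∈ 𝒞.members, (if v ∈ C ∧ P C then w C else 0) = 0 := by
  refine Finset.sum_eq_zero fun C _ => ?_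
  split_ifs with hvC
  · by_contra hne
    exact Finset.disjoint_left.1 (h.supp C hne).2 hv hvC.1
  · rfl

theorem sum_eq_of_mem {v : α} (hv : ∀ C, w C ≠ 0 → v ∈ C)
    (P : Finset α → Prop) [DecidablePred P] :
    ∑ C ∈ 𝒞.members, (if v ∈ C ∧ P C then w C else 0) =
      ∑ C ∈ 𝒞.members, (if P C then w C else 0) := by
  refine Finset.sum_congr rfl fun C _ => ?_
  by_cases hne : w C = 0
  · simp [hne]
  · simp [hv C hne]

theorem mem_of_mem_side (hno : 𝒞.NoIsolated I R) {x v : α} {b : Bool}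
    (h : 𝒞.IsHalfPacking (I ∪ 𝒞.side I R x b) (R \ 𝒞.comp I R x) w)
    (hv : v ∈ 𝒞.side I R x (!b)) (C : Finset α) (hC : w C ≠ 0) : v ∈ C :=
  hno.side_subset_of_disjoint (h.supp C hC).1 (h.supp C hC).2 hv

/-- An element of the component lies in all members of positive weight for one of the measures and
in none for the other, which averages to 1/2. Outside the component both marginals are already 1/2.
-/
theorem average (hno : 𝒞.NoIsolated I R) {x : α}
    (h₀ : 𝒞.IsHalfPacking (I ∪ 𝒞.side I R x false) (R \ 𝒞.comp I R x) w₀)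
    (h₁ : 𝒞.IsHalfPacking (I ∪ 𝒞.side I R x true) (R \ 𝒞.comp I R x) w₁) :
    𝒞.IsHalfPacking I R fun C => (w₀ C + w₁ C) / 2 where
  nonneg C := by have := h₀.nonneg C; have := h₁.nonneg C; positivity
  supp C hC := by
    by_cases h : w₀ C = 0
    · have h' : w₁ C ≠ 0 := by rintro h'; simp [h, h'] at hC
      exact ⟨(h₁.supp C h').1, Finset.disjoint_of_subset_left Finset.subset_union_left
        (h₁.supp C h').2⟩
    · exact ⟨(h₀.supp C h).1, Finset.disjoint_of_subset_left Finset.subset_union_left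
        (h₀.supp C h).2⟩
  total := by
    rw [← Finset.sum_div, Finset.sum_add_distrib, h₀.total, h₁.total]; norm_num
  half v hv := by
    have hsplit : ∑ C ∈ 𝒞.members, (if v ∈ C then (w₀ C + w₁ C) / 2 else 0) =
        ((∑ C ∈ 𝒞.members, if v ∈ C then w₀ C else 0) +
          ∑ C ∈ 𝒞.members, if v ∈ C then w₁ C else 0) / 2 := by
      rw [← Finset.sum_add_distrib, Finset.sum_div]
      refine Finset.sum_congr rfl fun C _ => ?_
      split_ifs <;> simp
    rw [hsplit]
    by_cases hvc : v ∈ 𝒞.comp I R x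
    · obtain ⟨b, hb⟩ := mem_comp_iff_exists_side.1 hvc
      cases b with
      | false =>
        have e0 := h₀.sum_eq_zero (v := v) (by simp [hb]) fun _ => True
        have e1 := sum_eq_of_mem (𝒞 := 𝒞) (mem_of_mem_side hno h₁ hb) fun _ => True
        simp only [and_true, if_true] at e0 e1
        rw [e0, e1, h₁.total]; norm_num
      | true =>
        have e0 := h₁.sum_eq_zero (v := v) (by simp [hb]) fun _ => True
        have e1 := sum_eq_of_mem (𝒞 := 𝒞) (mem_of_mem_side hno h₀ hb) fun _ => True
        simp only [and_true, if_true] at e0 e1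
        rw [e0, e1, h₀.total]; norm_num
    · have hv' : v ∈ R \ 𝒞.comp I R x := Finset.mem_sdiff.2 ⟨hv, hvc⟩
      rw [h₀.half v hv', h₁.half v hv']; norm_num

/-- A member of positive weight contains exactly one end of every edge of the pair graph. -/
theorem mem_iff_notMem_of_adj (h : 𝒞.IsHalfPacking I R w) {u v : α}
    (huv : (𝒞.pairGraph I R).Adj u v) {C : Finset α} (hC : w C ≠ 0) : u ∈ C ↔ v ∉ C := by
  have hor : ∀ D, w D ≠ 0 → u ∈ D ∨ v ∈ D := by
    intro D hD
    obtain ⟨t, ht⟩ := huv.2.2.2 D (h.supp D hD).1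
    simp only [Finset.mem_inter, Finset.mem_union, Finset.mem_insert, Finset.mem_singleton] at ht
    rcases ht.1 with h' | rfl | rfl
    · exact absurd ht.2 (Finset.disjoint_left.1 (h.supp D hD).2 h')
    · exact .inl ht.2
    · exact .inr ht.2
  -- Every member of positive weight contains at least one end. The two marginals sum to the total
  -- weight 1, which leaves no room for a member containing both.
  have hnand : ¬ (u ∈ C ∧ v ∈ C) := by
    rintro ⟨hu, hv⟩
    have hlt : ∑ D ∈ 𝒞.members, w D <
        ∑ D ∈ 𝒞.members, ((if u ∈ D then w D else 0) + if v ∈ D then w D else 0) := by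
      refine Finset.sum_lt_sum (fun D _ => ?_) ⟨C, (h.supp C hC).1, ?_⟩
      · by_cases hD : w D = 0
        · simp [hD]
        · have := h.nonneg D
          rcases hor D hD with h' | h' <;> simp only [h', if_true] <;> split_ifs <;> linarith
      · have := lt_of_le_of_ne (h.nonneg C) (Ne.symm hC)
        simp only [hu, hv, if_true]; linarith
    rw [Finset.sum_add_distrib, h.half u huv.2.1, h.half v huv.2.2.1, h.total] at hlt
    norm_num at hlt
  have := hor C hC
  tauto

end IsHalfPacking

/-- A clean clutter all of whose remaining elements lie in edges of the pair graph has a half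
packing. -/
theorem IsClean.exists_isHalfPacking (hclean : 𝒞.IsClean) (hl : 𝒞.Loose I R)
    (hno : 𝒞.NoIsolated I R) : ∃ w, 𝒞.IsHalfPacking I R w := by
  induction hn : R.card using Nat.strong_induction_on generalizing I R with
  | _ n ih =>
  subst hn
  rcases R.eq_empty_or_nonempty with rfl | ⟨x, hx⟩
  -- When nothing is kept, one member avoiding `I` carries all the weight.
  · obtain ⟨C, hC, hdis⟩ := not_hits_iff.1 hl.not_hits
    refine ⟨fun D => if D = C then 1 else 0, fun D => by positivity, fun D hD => ?_, ?_, by simp⟩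
    · obtain rfl : D = C := by by_contra h; simp [h] at hD
      exact ⟨hC, hdis⟩
    · simp [hC]
  · have hlt : (R \ 𝒞.comp I R x).card < R.card := by
      refine Finset.card_lt_card (Finset.ssubset_iff_subset_ne.2 ⟨Finset.sdiff_subset, fun h => ?_⟩)
      have := h.symm ▸ hx
      exact (Finset.mem_sdiff.1 this).2 (mem_comp.2 ⟨hx, .rfl⟩)
    obtain ⟨w₀, h₀⟩ := ih _ hlt (hclean.loose_side hl hx false) (hno.sdiff_comp x false) rfl
    obtain ⟨w₁, h₁⟩ := ih _ hlt (hclean.loose_side hl hx true) (hno.sdiff_comp x true) rfl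
    exact ⟨_, .average hno h₀ h₁⟩

end Clutter

/-! ### The Fano plane and equidistant sets of eight words. -/

/-- The lines of the Fano plane on `Fin 7`. -/
def fanoTriples : Finset (Finset (Fin 7)) :=
  {{0, 1, 2}, {0, 3, 4}, {0, 5, 6}, {1, 4, 5}, {1, 3, 6}, {2, 3, 5}, {2, 4, 6}}

/-- Words with even sum on every line of the Fano plane. -/
def IsFanoWord (q : Fin 7 → Bool) : Prop :=
  (q 0 ^^ q 1) = q 2 ∧ (q 0 ^^ q 3) = q 4 ∧ (q 0 ^^ q 5) = q 6 ∧ (q 1 ^^ q 4) = q 5 ∧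
    (q 1 ^^ q 3) = q 6 ∧ (q 2 ^^ q 3) = q 5 ∧ (q 2 ^^ q 4) = q 6

instance (q : Fin 7 → Bool) : Decidable (IsFanoWord q) := by
  unfold IsFanoWord; infer_instance

theorem xor_eq_false_iff {a b : Bool} : (a ^^ b) = false ↔ a = b := by
  cases a <;> cases b <;> simp

/-- Seven triples of `Fin 7` that pairwise meet in one point form a Fano plane. -/
theorem exists_perm_fanoTriples (𝓛 : Finset (Finset (Fin 7))) (h7 : 𝓛.card = 7)
    (h3 : ∀ L ∈ 𝓛, L.card = 3) (h1 : ∀ L ∈ 𝓛, ∀ L' ∈ 𝓛, L ≠ L' → (L ∩ L').card = 1) :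
    ∃ π : Equiv.Perm (Fin 7), 𝓛 = fanoTriples.image (Finset.image π) := by
  have huniq : ∀ x y, x ≠ y → ∀ L ∈ 𝓛, ∀ L' ∈ 𝓛, x ∈ L → y ∈ L → x ∈ L' → y ∈ L' → L = L' := by
    intro x y hxy L hL L' hL' h h' h'' h'''
    by_contra hne
    have := Finset.card_le_card (show {x, y} ⊆ L ∩ L' by
      intro z hz
      rcases Finset.mem_insert.1 hz with rfl | hz
      · exact Finset.mem_inter.2 ⟨h, h''⟩
      · rw [Finset.mem_singleton.1 hz]; exact Finset.mem_inter.2 ⟨h', h'''⟩)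
    rw [Finset.card_pair hxy, h1 L hL L' hL' hne] at this
    omega
  have hex : ∀ x y, x ≠ y → ∃ L ∈ 𝓛, x ∈ L ∧ y ∈ L := by
    -- The seven triples contain 7 · 3 = 21 distinct pairs, which is the number of all pairs of
    -- points, so every pair lies on a line.
    have hall : 𝓛.biUnion (Finset.powersetCard 2) = Finset.univ.powersetCard 2 := by
      refine Finset.eq_of_subset_of_card_le (fun P hP => ?_) ?_
      · obtain ⟨L, hL, hP⟩ := Finset.mem_biUnion.1 hP
        exact Finset.mem_powersetCard.2 ⟨Finset.subset_univ _, (Finset.mem_powersetCard.1 hP).2⟩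
      · rw [Finset.card_biUnion]
        · rw [Finset.sum_congr rfl fun L hL => by rw [Finset.card_powersetCard, h3 L hL]]
          simp [h7]; decide
        · intro L hL L' hL' hne
          rw [Function.onFun, Finset.disjoint_left]
          intro P hP hP'
          rw [Finset.mem_powersetCard] at hP hP'
          have := Finset.card_le_card (Finset.subset_inter hP.1 hP'.1)
          rw [hP.2, h1 L hL L' hL' hne] at this
          omega
    intro x y hxy
    have hm : {x, y} ∈ 𝓛.biUnion (Finset.powersetCard 2) := by
      rw [hall, Finset.mem_powersetCard]
      exact ⟨Finset.subset_univ _, Finset.card_pair hxy⟩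
    obtain ⟨L, hL, hP⟩ := Finset.mem_biUnion.1 hm
    have := (Finset.mem_powersetCard.1 hP).1
    exact ⟨L, hL, this (by simp), this (by simp)⟩
  have hthird : ∀ x y, x ≠ y → ∃ z, z ≠ x ∧ z ≠ y ∧ {x, y, z} ∈ 𝓛 := by
    intro x y hxy
    obtain ⟨L, hL, hx, hy⟩ := hex x y hxy
    have hsub : {x, y} ⊆ L := Finset.insert_subset hx (Finset.singleton_subset_iff.2 hy)
    have hc : (L \ {x, y}).card = 1 := by
      rw [Finset.card_sdiff_of_subset hsub, h3 L hL, Finset.card_pair hxy]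
    obtain ⟨z, hz⟩ := Finset.card_eq_one.1 hc
    have hz' : z ∈ L \ {x, y} := by simp [hz]
    simp only [Finset.mem_sdiff, Finset.mem_insert, Finset.mem_singleton, not_or] at hz'
    refine ⟨z, hz'.2.1, hz'.2.2, ?_⟩
    have : L = {x, y, z} := by
      rw [← Finset.sdiff_union_of_subset hsub, hz]
      ext t; simp; tauto
    exact this ▸ hL
  -- Coordinates: `a b c` is a line, `d` is a point off it, and `e`, `f`, `g` are the third points
  -- on the lines joining `d` to `a`, `b`, `c`. The remaining three lines are then forced.
  obtain ⟨a, b, hab⟩ : ∃ a b : Fin 7, a ≠ b := ⟨0, 1, by decide⟩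
  obtain ⟨c, hca, hcb, l1⟩ := hthird a b hab
  obtain ⟨d, hd⟩ : ∃ d : Fin 7, d ∉ ({a, b, c} : Finset (Fin 7)) := by
    by_contra! hcon
    have h := Finset.card_le_card (fun x _ => hcon x : Finset.univ ⊆ {a, b, c})
    rw [h3 _ l1] at h
    simp at h
  simp only [Finset.mem_insert, Finset.mem_singleton, not_or, ← ne_eq] at hd
  obtain ⟨hda, hdb, hdc⟩ := hd
  obtain ⟨e, hea, hed, l2⟩ := hthird a d hda.symm
  obtain ⟨f, hfb, hfd, l3⟩ := hthird b d hdb.symm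
  obtain ⟨g, hgc, hgd, l4⟩ := hthird c d hdc.symm
  have key : ∀ x y, x ≠ y → ∀ L ∈ 𝓛, ∀ L' ∈ 𝓛, x ∈ L → y ∈ L → x ∈ L' → y ∈ L' →
      ∀ z ∈ L, z ∈ L' := fun x y hxy L hL L' hL' h h' h'' h''' z hz =>
    huniq x y hxy L hL L' hL' h h' h'' h''' ▸ hz
  have heb : e ≠ b := by
    rintro rfl
    have := key a e hab _ l2 _ l1 (by simp) (by simp) (by simp) (by simp) d (by simp)
    simp [hda, hdb, hdc] at this
  have hec : e ≠ c := by
    rintro rfl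
    have := key a e hca.symm _ l2 _ l1 (by simp) (by simp) (by simp) (by simp) d (by simp)
    simp [hda, hdb, hdc] at this
  have hfa : f ≠ a := by
    rintro rfl
    have := key f b hab _ l3 _ l1 (by simp) (by simp) (by simp) (by simp) d (by simp)
    simp [hda, hdb, hdc] at this
  have hfc : f ≠ c := by
    rintro rfl
    have := key f b hcb _ l3 _ l1 (by simp) (by simp) (by simp) (by simp) d (by simp)
    simp [hda, hdb, hdc] at this
  have hga : g ≠ a := by
    rintro rfl
    have := key g c hgc _ l4 _ l1 (by simp) (by simp) (by simp) (by simp) d (by simp)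
    simp [hda, hdb, hdc] at this
  have hgb : g ≠ b := by
    rintro rfl
    have := key g c hgc _ l4 _ l1 (by simp) (by simp) (by simp) (by simp) d (by simp)
    simp [hda, hdb, hdc] at this
  have hef : e ≠ f := by
    rintro rfl
    have := key d e hed.symm _ l3 _ l2 (by simp) (by simp) (by simp) (by simp) b (by simp)
    simp [hab.symm, hdb.symm, heb.symm] at this
  have heg : e ≠ g := by
    rintro rfl
    have := key d e hed.symm _ l4 _ l2 (by simp) (by simp) (by simp) (by simp) c (by simp)
    simp [hca, hdc.symm, hec.symm] at this
  have hfg : f ≠ g := by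
    rintro rfl
    have := key d f hfd.symm _ l4 _ l3 (by simp) (by simp) (by simp) (by simp) c (by simp)
    simp [hcb, hdc.symm, hfc.symm] at this
  -- `g` precedes `f` because in `fanoTriples` the line through 2 and 3 contains 5 and the line
  -- through 1 and 3 contains 6.
  have hinj : Function.Injective ![a, b, c, d, e, g, f] := by
    have : List.Nodup [a, b, c, d, e, g, f] := by
      simp only [List.nodup_cons, List.mem_cons, List.not_mem_nil, or_false, not_or,
        List.nodup_nil, and_true, not_false_eq_true]
      exact ⟨⟨hab, hca.symm, hda.symm, hea.symm, hga.symm, hfa.symm⟩,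
        ⟨hcb.symm, hdb.symm, heb.symm, hgb.symm, hfb.symm⟩,
        ⟨hdc.symm, hec.symm, hgc.symm, hfc.symm⟩, ⟨hed.symm, hgd.symm, hfd.symm⟩,
        ⟨heg, hef⟩, hfg.symm⟩
    have h := List.nodup_iff_injective_get.1 this
    intro i j hij
    apply h
    fin_cases i <;> fin_cases j <;> first | rfl | exact hij
  have hall : ∀ z, z = a ∨ z = b ∨ z = c ∨ z = d ∨ z = e ∨ z = g ∨ z = f := by
    intro z
    obtain ⟨i, rfl⟩ := (Finite.injective_iff_surjective.1 hinj) z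
    fin_cases i <;> simp
  have l5 : {a, g, f} ∈ 𝓛 := by
    obtain ⟨z, hza, hzf, l⟩ := hthird a f hfa.symm
    have : z = g := by
      rcases hall z with rfl | rfl | rfl | rfl | rfl | rfl | rfl
      · exact absurd rfl hza
      · have := key a z hab _ l _ l1 (by simp) (by simp) (by simp) (by simp) f (by simp)
        simp [hfa, hfb, hfc] at this
      · have := key a z hca.symm _ l _ l1 (by simp) (by simp) (by simp) (by simp) f (by simp)
        simp [hfa, hfb, hfc] at this
      · have := key a z hda.symm _ l _ l2 (by simp) (by simp) (by simp) (by simp) f (by simp)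
        simp [hfa, hfd, hef.symm] at this
      · have := key a z hea.symm _ l _ l2 (by simp) (by simp) (by simp) (by simp) f (by simp)
        simp [hfa, hfd, hef.symm] at this
      · rfl
      · exact absurd rfl hzf
    subst this
    rwa [Finset.pair_comm] at l
  have l6 : {b, e, g} ∈ 𝓛 := by
    obtain ⟨z, hzb, hze, l⟩ := hthird b e heb.symm
    have : z = g := by
      rcases hall z with rfl | rfl | rfl | rfl | rfl | rfl | rfl
      · have := key b z hab.symm _ l _ l1 (by simp) (by simp) (by simp) (by simp) e (by simp)
        simp [hea, heb, hec] at this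
      · exact absurd rfl hzb
      · have := key b z hcb.symm _ l _ l1 (by simp) (by simp) (by simp) (by simp) e (by simp)
        simp [hea, heb, hec] at this
      · have := key b z hdb.symm _ l _ l3 (by simp) (by simp) (by simp) (by simp) e (by simp)
        simp [heb, hed, hef] at this
      · exact absurd rfl hze
      · rfl
      · have := key b z hfb.symm _ l _ l3 (by simp) (by simp) (by simp) (by simp) e (by simp)
        simp [heb, hed, hef] at this
    subst this
    exact l
  have l7 : {c, e, f} ∈ 𝓛 := by
    obtain ⟨z, hzc, hze, l⟩ := hthird c e hec.symm
    have : z = f := by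
      rcases hall z with rfl | rfl | rfl | rfl | rfl | rfl | rfl
      · have := key c z hca _ l _ l1 (by simp) (by simp) (by simp) (by simp) e (by simp)
        simp [hea, heb, hec] at this
      · have := key c z hcb _ l _ l1 (by simp) (by simp) (by simp) (by simp) e (by simp)
        simp [hea, heb, hec] at this
      · exact absurd rfl hzc
      · have := key c z hdc.symm _ l _ l4 (by simp) (by simp) (by simp) (by simp) e (by simp)
        simp [hec, hed, heg] at this
      · exact absurd rfl hze
      · have := key c z hgc.symm _ l _ l4 (by simp) (by simp) (by simp) (by simp) e (by simp)
        simp [hec, hed, heg] at this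
      · rfl
    subst this
    exact l
  refine ⟨Equiv.ofBijective _ (Finite.injective_iff_bijective.1 hinj), ?_⟩
  symm
  refine Finset.eq_of_subset_of_card_le ?_ ?_
  · intro L hL
    obtain ⟨T, hT, rfl⟩ := Finset.mem_image.1 hL
    simp only [fanoTriples, Finset.mem_insert, Finset.mem_singleton] at hT
    rcases hT with rfl | rfl | rfl | rfl | rfl | rfl | rfl <;>
      simp only [Finset.image_insert, Finset.image_singleton, Equiv.ofBijective_apply]
    exacts [l1, l2, l5, l6, l3, l4, l7]
  · rw [Finset.card_image_of_injective _ (Finset.image_injective (Equiv.injective _)), h7]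
    decide

-- The nonzero words are the indicators of the complements of the lines.
set_option maxRecDepth 100000 in
theorem isFanoWord_iff (q : Fin 7 → Bool) :
    IsFanoWord q ↔ q = (fun _ => false) ∨
      (Finset.univ.filter fun i => q i = false) ∈ fanoTriples := by
  revert q
  decide

/-- Eight binary words of length seven that pairwise agree in three positions are, after a
permutation and a translation, the words with even sum on the lines of the Fano plane. -/
theorem exists_perm_isFanoWord (B : Finset (Fin 7 → Bool)) (h8 : B.card = 8)
    (hB : ∀ p ∈ B, ∀ q ∈ B, p ≠ q → (Finset.univ.filter fun i => p i = q i).card = 3) :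
    ∃ (π : Equiv.Perm (Fin 7)) (p : Fin 7 → Bool),
      ∀ q, q ∈ B ↔ IsFanoWord fun i => (q (π i) ^^ p (π i)) := by
  obtain ⟨p, hp⟩ : B.Nonempty := Finset.card_pos.1 (by omega)
  set Z : (Fin 7 → Bool) → Finset (Fin 7) := fun q => Finset.univ.filter fun i => q i = p i with hZ
  have hZinj : Function.Injective Z := by
    intro q q' h
    funext i
    have : i ∈ Z q ↔ i ∈ Z q' := by rw [h]
    simp only [hZ, Finset.mem_filter, Finset.mem_univ, true_and] at this
    revert this
    cases q i <;> cases q' i <;> cases p i <;> simp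
  obtain ⟨π, hπ⟩ := exists_perm_fanoTriples ((B.erase p).image Z)
    (by rw [Finset.card_image_of_injective _ hZinj, Finset.card_erase_of_mem hp, h8])
    (by
      intro L hL
      obtain ⟨q, hq, rfl⟩ := Finset.mem_image.1 hL
      rw [Finset.mem_erase] at hq
      exact hB q hq.2 p hp hq.1)
    (by
      intro L hL L' hL' hne
      obtain ⟨q, hq, rfl⟩ := Finset.mem_image.1 hL
      obtain ⟨q', hq', rfl⟩ := Finset.mem_image.1 hL'
      rw [Finset.mem_erase] at hq hq'
      have e1 : (Z q).card = 3 := hB q hq.2 p hp hq.1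
      have e2 : (Z q').card = 3 := hB q' hq'.2 p hp hq'.1
      have e3 := hB q hq.2 q' hq'.2 fun h => hne (h ▸ rfl)
      -- Two words agree where both or neither agree with `p`. With `m` common points of the two
      -- triples this gives 3 = m + 7 − (6 − m), so m = 1.
      have e4 : (Finset.univ.filter fun i => q i = q' i) = (Z q ∩ Z q') ∪ (Z q ∪ Z q')ᶜ := by
        ext i
        simp only [hZ, Finset.mem_filter, Finset.mem_univ, true_and, Finset.mem_union,
          Finset.mem_inter, Finset.mem_compl]
        cases q i <;> cases q' i <;> cases p i <;> simp
      rw [e4, Finset.card_union_of_disjoint, Finset.card_compl, Fintype.card_fin] at e3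
      · have e5 := Finset.card_union_add_card_inter (Z q) (Z q')
        have e6 := Finset.card_le_univ (Z q ∪ Z q')
        rw [Fintype.card_fin] at e6
        omega
      · exact (disjoint_compl_right).mono_left
          (Finset.inter_subset_left.trans Finset.subset_union_left))
  refine ⟨π, p, fun q => ?_⟩
  rw [isFanoWord_iff]
  have hz : Z q = (Finset.univ.filter fun i => (q (π i) ^^ p (π i)) = false).image π := by
    ext j
    simp only [hZ, Finset.mem_filter, Finset.mem_univ, true_and, Finset.mem_image,
      xor_eq_false_iff]
    constructor
    · exact fun h => ⟨π.symm j, by simpa using h, by simp⟩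
    · rintro ⟨i, hi, rfl⟩; exact hi
  have h0 : (fun i => (q (π i) ^^ p (π i))) = (fun _ => false) ↔ q = p := by
    simp only [funext_iff, xor_eq_false_iff]
    exact (π.surjective.forall (p := fun i => q i = p i)).symm
  have h1 : (Finset.univ.filter fun i => (q (π i) ^^ p (π i)) = false) ∈ fanoTriples ↔
      q ∈ B.erase p := by
    rw [← hZinj.mem_finset_image (s := B.erase p), hπ, hz,
      (Finset.image_injective π.injective).mem_finset_image]
  rw [h0, h1, Finset.mem_erase]
  by_cases h : q = p
  · simp [h, hp]
  · simp [h]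

/-! ### Tangled clutters: representatives of components and transversal members. -/

namespace Clutter

variable {α : Type*} [DecidableEq α] {𝒞 : Clutter α}

theorem IsTangled.loose (h : 𝒞.IsTangled) : 𝒞.Loose ∅ 𝒞.ground := by
  have hle : ∀ B ⊆ 𝒞.ground, 𝒞.Hits B → 2 ≤ B.card := by
    intro B hB hit
    have : 𝒞.coveringNumber ≤ (B.card : ℕ∞) := iInf_le (fun B : {B // 𝒞.IsCover B} =>
      (B.1.card : ℕ∞)) ⟨B, hB, hit⟩
    rw [h.1] at this
    exact_mod_cast this
  refine ⟨by simp, subset_rfl, by simp, fun hit => ?_, fun x hx hit => ?_⟩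
  · have := hle ∅ (by simp) hit
    simp at this
  · have := hle _ (by simpa using hx) hit
    simp at this

theorem IsTangled.isMinimumCover_pair_iff (h : 𝒞.IsTangled) {u v : α} :
    (u ≠ v ∧ 𝒞.IsMinimumCover {u, v}) ↔ (𝒞.pairGraph ∅ 𝒞.ground).Adj u v := by
  constructor
  · rintro ⟨hne, hc, -⟩
    exact ⟨hne, hc.1 (by simp), hc.1 (by simp),
      Hits.mono (A := {u, v}) hc.2 Finset.subset_union_right⟩
  · rintro ⟨hne, hu, hv, hit⟩
    refine ⟨hne, ⟨by grind, fun C hC => by simpa using hit C hC⟩, ?_⟩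
    rw [h.1, Finset.card_pair hne]; rfl

theorem IsTangled.noIsolated (h : 𝒞.IsTangled) : 𝒞.NoIsolated ∅ 𝒞.ground := by
  intro v hv
  obtain ⟨B, hB, hvB⟩ := h.2 v hv
  have h2 : B.card = 2 := by
    have := hB.2
    rw [h.1] at this
    exact_mod_cast this
  obtain ⟨x, y, hxy, rfl⟩ := Finset.card_eq_two.1 h2
  have hadj := h.isMinimumCover_pair_iff.1 ⟨hxy, hB⟩
  rcases Finset.mem_insert.1 hvB with rfl | hvy
  · exact ⟨y, hadj⟩
  · rw [Finset.mem_singleton.1 hvy]; exact ⟨x, hadj.symm⟩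

/-- Representatives of the components of the pair graph of a tangled clutter. -/
theorem IsTangled.exists_representatives (h : 𝒞.IsTangled) {n : ℕ} (hr : 𝒞.rank = n)
    (hn : n ≠ 0) :
    ∃ r : Fin n → α, (∀ i, r i ∈ 𝒞.ground) ∧
      (∀ i j, (𝒞.pairGraph ∅ 𝒞.ground).Reachable (r i) (r j) → i = j) ∧
      ∀ v ∈ 𝒞.ground, ∃ i, (𝒞.pairGraph ∅ 𝒞.ground).Reachable (r i) v := by
  have hfin : Finite 𝒞.coverGraph.ConnectedComponent := by
    refine Nat.finite_of_card_ne_zero ?_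
    rw [show Nat.card _ = n from hr]; exact hn
  obtain ⟨e⟩ : Nonempty (𝒞.coverGraph.ConnectedComponent ≃ Fin n) :=
    ⟨Finite.equivFinOfCardEq hr⟩
  have hadj : ∀ u v : {v // v ∈ 𝒞.ground}, 𝒞.coverGraph.Adj u v ↔
      (𝒞.pairGraph ∅ 𝒞.ground).Adj u.1 v.1 := by
    intro u v
    rw [← h.isMinimumCover_pair_iff, ne_eq, ← Subtype.ext_iff]
    rfl
  have hreach : ∀ u v : {v // v ∈ 𝒞.ground}, 𝒞.coverGraph.Reachable u v ↔
      (𝒞.pairGraph ∅ 𝒞.ground).Reachable u.1 v.1 := by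
    intro u v
    constructor
    · rintro ⟨p⟩
      exact ⟨p.map (⟨Subtype.val, fun {a b} hab => (hadj a b).1 hab⟩ :
        𝒞.coverGraph →g 𝒞.pairGraph ∅ 𝒞.ground)⟩
    · rintro ⟨p⟩
      have key : ∀ (x y : α) (p : (𝒞.pairGraph ∅ 𝒞.ground).Walk x y) (hx : x ∈ 𝒞.ground)
          (hy : y ∈ 𝒞.ground), 𝒞.coverGraph.Reachable ⟨x, hx⟩ ⟨y, hy⟩ := by
        intro x y p
        induction p with
        | nil => exact fun _ _ => .rfl
        | @cons a b c hab p ih =>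
          intro hx hy
          have hb := hab.2.2.1
          exact ((hadj ⟨a, hx⟩ ⟨b, hb⟩).2 hab).reachable.trans (ih hb hy)
      exact key _ _ p u.2 v.2
  have hout : ∀ i, ∃ v, 𝒞.coverGraph.connectedComponentMk v = e.symm i :=
    fun i => (e.symm i).exists_rep
  choose r hr using hout
  refine ⟨fun i => (r i).1, fun i => (r i).2, fun i j hij => ?_, fun v hv => ?_⟩
  · rw [← hreach, ← SimpleGraph.ConnectedComponent.eq, hr, hr] at hij
    exact e.symm.injective hij
  · refine ⟨e (𝒞.coverGraph.connectedComponentMk ⟨v, hv⟩), ?_⟩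
    rw [← hreach _ ⟨v, hv⟩, ← SimpleGraph.ConnectedComponent.eq, hr, e.symm_apply_apply]

/-- A unique fractional packing of value two amounts to a unique half packing. -/
theorem IsHalfPacking.eq_of_unique
    (hunique : ∃! y : {C // C ∈ 𝒞.members} → ℝ,
      𝒞.IsFractionalPacking y ∧ 𝒞.packingValue y = 2) {w w' : Finset α → ℝ}
    (h : 𝒞.IsHalfPacking ∅ 𝒞.ground w) (h' : 𝒞.IsHalfPacking ∅ 𝒞.ground w') :
    ∀ C ∈ 𝒞.members, w C = w' C := by
  have key : ∀ w, 𝒞.IsHalfPacking ∅ 𝒞.ground w →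
      𝒞.IsFractionalPacking (fun C => 2 * w C.1) ∧
        𝒞.packingValue (fun C => 2 * w C.1) = 2 := by
    intro w h
    refine ⟨⟨fun C => by have := h.nonneg C.1; positivity, fun v hv => ?_⟩, ?_⟩
    · rw [Finset.sum_filter, Finset.univ_eq_attach,
        Finset.sum_attach 𝒞.members (fun C => if v ∈ C then 2 * w C else 0)]
      have := h.half v hv
      simp only [← mul_ite_zero, ← Finset.mul_sum, this]
      norm_num
    · rw [packingValue, Finset.univ_eq_attach, Finset.sum_attach 𝒞.members (fun C => 2 * w C),
        ← Finset.mul_sum, h.total]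
      norm_num
  intro C hC
  have := congrFun (hunique.unique (key w h) (key w' h')) ⟨C, hC⟩
  simpa using this

/-- A member containing exactly one end of every edge of the pair graph. -/
def IsTransversal (𝒞 : Clutter α) (C : Finset α) : Prop :=
  C ∈ 𝒞.members ∧ ∀ u v, (𝒞.pairGraph ∅ 𝒞.ground).Adj u v → (u ∈ C ↔ v ∉ C)

theorem IsTransversal.mem_iff {C : Finset α} (h : 𝒞.IsTransversal C) {b : Bool} {u v : α}
    (huv : (𝒞.pairGraph ∅ 𝒞.ground).ParityReachable b u v) :
    decide (v ∈ C) = (decide (u ∈ C) ^^ b) := by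
  obtain ⟨p, rfl⟩ := huv
  induction p with
  | nil => simp
  | @cons a b c hab p ih =>
    rw [ih, SimpleGraph.Walk.length_cons, Nat.bodd_succ]
    have := h.2 a b hab
    by_cases ha : a ∈ C <;> by_cases hb : b ∈ C <;> simp_all

end Clutter

/-! ### Consequences of uniqueness: uncorrelated signs and the kernel identity. -/

namespace Clutter

variable {α : Type*} [DecidableEq α] {𝒞 : Clutter α}

/-- The sign vector coordinate of a set at an element. -/
def sgn (C : Finset α) (x : α) : ℝ := if x ∈ C then 1 else -1

theorem sgn_eq (C : Finset α) (x : α) : sgn C x = 2 * (if x ∈ C then 1 else 0) - 1 := by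
  unfold sgn; split_ifs <;> norm_num

theorem sgn_mul_self (C : Finset α) (x : α) : sgn C x * sgn C x = 1 := by
  unfold sgn; split_ifs <;> norm_num

theorem IsTransversal.indicator_eq {C : Finset α} (h : 𝒞.IsTransversal C) {b : Bool} {u v : α}
    (huv : (𝒞.pairGraph ∅ 𝒞.ground).ParityReachable b u v) :
    (if v ∈ C then (1 : ℝ) else 0) = (1 + (if b then -1 else 1) * sgn C u) / 2 := by
  have := h.mem_iff huv
  unfold sgn
  by_cases hu : u ∈ C <;> by_cases hv : v ∈ C <;> cases b <;> simp_all

theorem IsHalfPacking.isTransversal {w : Finset α → ℝ} (h : 𝒞.IsHalfPacking ∅ 𝒞.ground w)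
    {C : Finset α} (hC : w C ≠ 0) : 𝒞.IsTransversal C :=
  ⟨(h.supp C hC).1, fun _ _ huv => h.mem_iff_notMem_of_adj huv hC⟩

section unique

variable {w : Finset α → ℝ}
  (hclean : 𝒞.IsClean) (hl : 𝒞.Loose ∅ 𝒞.ground) (hno : 𝒞.NoIsolated ∅ 𝒞.ground)
  (huniq : ∀ w w', 𝒞.IsHalfPacking ∅ 𝒞.ground w → 𝒞.IsHalfPacking ∅ 𝒞.ground w' →
    ∀ C ∈ 𝒞.members, w C = w' C)
  (h : 𝒞.IsHalfPacking ∅ 𝒞.ground w)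

include hclean hl hno huniq h

/-- By uniqueness the half packing is the average of two others, one with `x` in no member and one
with `x` in every member of positive weight. Only the second contributes, with half its marginal 1/2
at `v`. -/
theorem sum_pair_eq_quarter {x v : α} (hx : x ∈ 𝒞.ground)
    (hv : v ∈ 𝒞.ground \ 𝒞.comp ∅ 𝒞.ground x) :
    ∑ C ∈ 𝒞.members, (if x ∈ C ∧ v ∈ C then w C else 0) = 1 / 4 := by
  obtain ⟨w₀, h₀⟩ := hclean.exists_isHalfPacking (hclean.loose_side hl hx false)
    (hno.sdiff_comp x false)
  obtain ⟨w₁, h₁⟩ := hclean.exists_isHalfPacking (hclean.loose_side hl hx true)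
    (hno.sdiff_comp x true)
  have hw := huniq _ _ h (.average hno h₀ h₁)
  have hxs : x ∈ 𝒞.side ∅ 𝒞.ground x false := mem_side.2 ⟨hx, .refl _ _⟩
  have e0 := h₀.sum_eq_zero (v := x) (by simp [hxs]) fun C => v ∈ C
  have e1 := IsHalfPacking.sum_eq_of_mem (𝒞 := 𝒞) (IsHalfPacking.mem_of_mem_side hno h₁ hxs)
    fun C => v ∈ C
  rw [h₁.half v hv] at e1
  have : ∑ C ∈ 𝒞.members, (if x ∈ C ∧ v ∈ C then w C else 0) =
      ((∑ C ∈ 𝒞.members, if x ∈ C ∧ v ∈ C then w₀ C else 0) +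
        ∑ C ∈ 𝒞.members, if x ∈ C ∧ v ∈ C then w₁ C else 0) / 2 := by
    rw [← Finset.sum_add_distrib, Finset.sum_div]
    refine Finset.sum_congr rfl fun C hC => ?_
    rw [hw C hC]
    split_ifs <;> simp
  rw [this, e0, e1]; norm_num

omit hclean hl hno huniq in
theorem sum_mul_sgn {x : α} (hx : x ∈ 𝒞.ground) : ∑ C ∈ 𝒞.members, w C * sgn C x = 0 := by
  have h1 := h.half x hx
  have h2 := h.total
  have : ∀ C, w C * sgn C x = 2 * (if x ∈ C then w C else 0) - w C := by
    intro C; rw [sgn_eq]; split_ifs <;> ring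
  simp only [this, Finset.sum_sub_distrib, ← Finset.mul_sum]
  rw [h1, h2]; norm_num

theorem sum_mul_sgn_mul_sgn {x v : α} (hx : x ∈ 𝒞.ground)
    (hv : v ∈ 𝒞.ground \ 𝒞.comp ∅ 𝒞.ground x) :
    ∑ C ∈ 𝒞.members, w C * (sgn C x * sgn C v) = 0 := by
  have h1 := h.half x hx
  have h2 := h.half v (Finset.mem_sdiff.1 hv).1
  have h3 := h.total
  have h4 := sum_pair_eq_quarter hclean hl hno huniq h hx hv
  have : ∀ C, w C * (sgn C x * sgn C v) = 4 * (if x ∈ C ∧ v ∈ C then w C else 0) -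
      2 * (if x ∈ C then w C else 0) - 2 * (if v ∈ C then w C else 0) + w C := by
    intro C
    unfold sgn
    by_cases hx : x ∈ C <;> by_cases hv : v ∈ C <;> simp [hx, hv] <;> ring
  simp only [this, Finset.sum_sub_distrib, Finset.sum_add_distrib, ← Finset.mul_sum]
  rw [h1, h2, h3, h4]; norm_num

variable {r : Fin 7 → α} (hr : ∀ i, r i ∈ 𝒞.ground)
  (hr1 : ∀ i j, (𝒞.pairGraph ∅ 𝒞.ground).Reachable (r i) (r j) → i = j)
  (hr2 : ∀ v ∈ 𝒞.ground, ∃ i, (𝒞.pairGraph ∅ 𝒞.ground).Reachable (r i) v)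

include hr hr1

/-- For the inner product weighted by `w`, the constant 1 and the seven sign functions are
orthonormal. The bracket is the reproducing kernel of their span at `D`. -/
theorem sum_mul_kernel_mul_sgn (D : Finset α) (k : Fin 7) :
    ∑ C ∈ 𝒞.members, w C * (1 + ∑ i, sgn C (r i) * sgn D (r i)) * sgn C (r k) =
      sgn D (r k) := by
  have hexp : ∀ C, w C * (1 + ∑ i, sgn C (r i) * sgn D (r i)) * sgn C (r k) =
      w C * sgn C (r k) + ∑ i, sgn D (r i) * (w C * (sgn C (r i) * sgn C (r k))) := by
    intro C
    rw [mul_add, add_mul, mul_one, Finset.mul_sum, Finset.sum_mul]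
    congr 1
    exact Finset.sum_congr rfl fun i _ => by ring
  simp only [hexp, Finset.sum_add_distrib]
  rw [sum_mul_sgn h (hr k), Finset.sum_comm, zero_add]
  simp only [← Finset.mul_sum]
  rw [Finset.sum_eq_single k]
  · simp only [sgn_mul_self, mul_one]
    rw [h.total, mul_one]
  · intro i _ hik
    rw [sum_mul_sgn_mul_sgn hclean hl hno huniq h (hr i), mul_zero]
    refine Finset.mem_sdiff.2 ⟨hr k, fun hc => hik (hr1 i k (mem_comp.1 hc).2)⟩
  · simp

include hr2

/-- Replacing `w` by `w (1 - K / 8) + 1 / 8` at `D` preserves the total and, by the reproducing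
property, all marginals. It stays nonnegative because `K ≤ 1 + 7 = 8`. Uniqueness makes the
perturbation vanish, and that is the identity. `D` is not assumed to have positive weight. -/
theorem weight_mul_kernel {D : Finset α} (hD : 𝒞.IsTransversal D) {C : Finset α}
    (hC : C ∈ 𝒞.members) :
    w C * (1 + ∑ i, sgn C (r i) * sgn D (r i)) = if C = D then 1 else 0 := by
  set K : Finset α → ℝ := fun C => 1 + ∑ i, sgn C (r i) * sgn D (r i) with hK
  set w' : Finset α → ℝ := fun C => w C * (1 - K C / 8) + (if C = D then 1 / 8 else 0) with hw'
  have hK8 : ∀ C, K C ≤ 8 := by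
    intro C
    have : ∑ i : Fin 7, sgn C (r i) * sgn D (r i) ≤ ∑ i : Fin 7, (1 : ℝ) := by
      refine Finset.sum_le_sum fun i _ => ?_
      unfold sgn; split_ifs <;> norm_num
    simp at this
    simp only [hK]; linarith
  have htr : ∀ C, w' C ≠ 0 → 𝒞.IsTransversal C := by
    intro C hC
    by_cases hCD : C = D
    · rwa [hCD]
    · refine h.isTransversal fun h0 => hC ?_
      simp [hw', h0, hCD]
  have hKtot : ∑ C ∈ 𝒞.members, w C * K C = 1 := by
    simp only [hK, mul_add, mul_one, Finset.sum_add_distrib, Finset.mul_sum]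
    rw [h.total, Finset.sum_comm, Finset.sum_eq_zero, add_zero]
    intro i _
    simp only [← mul_assoc]
    rw [← Finset.sum_mul, sum_mul_sgn h (hr i), zero_mul]
  have htot : ∑ C ∈ 𝒞.members, w' C = 1 := by
    have : ∀ C, w' C = w C - w C * K C / 8 + (if C = D then 1 / 8 else 0) := fun C => by
      simp only [hw']; ring
    simp only [this, Finset.sum_add_distrib, Finset.sum_sub_distrib, ← Finset.sum_div]
    rw [hKtot, h.total, Finset.sum_ite_eq' 𝒞.members D, if_pos hD.1]; norm_num
  have hsg : ∀ k, ∑ C ∈ 𝒞.members, w' C * sgn C (r k) = 0 := by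
    intro k
    have : ∀ C, w' C * sgn C (r k) = w C * sgn C (r k) - w C * K C * sgn C (r k) / 8 +
        (if C = D then sgn D (r k) / 8 else 0) := fun C => by
      simp only [hw']; split_ifs with hCD
      · subst hCD; ring
      · ring
    simp only [this, Finset.sum_add_distrib, Finset.sum_sub_distrib, ← Finset.sum_div]
    rw [sum_mul_kernel_mul_sgn hclean hl hno huniq h hr hr1 D k, sum_mul_sgn h (hr k),
      Finset.sum_ite_eq' 𝒞.members D, if_pos hD.1]; ring
  have hhp : 𝒞.IsHalfPacking ∅ 𝒞.ground w' := by
    refine ⟨fun C => ?_, fun C hC => ⟨(htr C hC).1, Finset.disjoint_empty_left _⟩, htot,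
      fun v hv => ?_⟩
    · have := h.nonneg C
      have h8 : 0 ≤ 1 - K C / 8 := by have := hK8 C; linarith
      simp only [hw']; positivity
    · obtain ⟨i, hi⟩ := hr2 v hv
      obtain ⟨b, hb⟩ := hi.exists_parity
      have : ∀ C, (if v ∈ C then w' C else 0) =
          (w' C + (if b then -1 else 1) * (w' C * sgn C (r i))) / 2 := by
        intro C
        by_cases h0 : w' C = 0
        · simp [h0]
        · have := (htr C h0).indicator_eq hb
          calc (if v ∈ C then w' C else 0) = w' C * (if v ∈ C then 1 else 0) := by simp
            _ = _ := by rw [this]; ring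
      simp only [this, ← Finset.sum_div, Finset.sum_add_distrib, ← Finset.mul_sum]
      rw [htot, hsg i]; norm_num
  have heq := huniq _ _ h hhp C hC
  simp only [hw'] at heq
  split_ifs at heq ⊢ with hCD <;> linarith

open Classical in
/-- The patterns of the transversal members on the seven representatives are eight words of length
seven that pairwise agree in three positions. -/
theorem transversal_words :
    ((𝒞.members.filter 𝒞.IsTransversal).image fun C i => decide (r i ∈ C)).card = 8 ∧
      ∀ C D, 𝒞.IsTransversal C → 𝒞.IsTransversal D →
        (fun i => decide (r i ∈ C)) ≠ (fun i => decide (r i ∈ D)) →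
        (Finset.univ.filter fun i => decide (r i ∈ C) = decide (r i ∈ D)).card = 3 := by
  -- The kernel is 1 plus agreements minus disagreements over seven positions: it is 8 for equal
  -- words and 0 exactly at three agreements.
  have hker : ∀ C D : Finset α, (1 + ∑ i, sgn C (r i) * sgn D (r i)) =
      2 * (Finset.univ.filter fun i => decide (r i ∈ C) = decide (r i ∈ D)).card - 6 := by
    intro C D
    have : ∀ i, sgn C (r i) * sgn D (r i) =
        2 * (if decide (r i ∈ C) = decide (r i ∈ D) then 1 else 0) - 1 := by
      intro i
      unfold sgn
      by_cases h1 : r i ∈ C <;> by_cases h2 : r i ∈ D <;> simp [h1, h2] <;> norm_num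
    simp only [this, Finset.sum_sub_distrib, ← Finset.mul_sum, Finset.sum_boole]
    simp; ring
  have hself : ∀ D, 𝒞.IsTransversal D → w D = 1 / 8 := by
    intro D hD
    have := weight_mul_kernel hclean hl hno huniq h hr hr1 hr2 hD hD.1
    rw [if_pos rfl] at this
    simp only [sgn_mul_self] at this
    simp at this
    linarith
  have hdist : ∀ C D, 𝒞.IsTransversal C → 𝒞.IsTransversal D → C ≠ D →
      (Finset.univ.filter fun i => decide (r i ∈ C) = decide (r i ∈ D)).card = 3 := by
    intro C D hC hD hne
    have := weight_mul_kernel hclean hl hno huniq h hr hr1 hr2 hD hC.1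
    rw [if_neg hne, hself C hC, hker] at this
    have h6 : ((Finset.univ.filter fun i => decide (r i ∈ C) = decide (r i ∈ D)).card : ℝ) = 3 := by
      linarith
    exact_mod_cast h6
  refine ⟨?_, fun C D hC hD hne => hdist C D hC hD fun h => hne (by rw [h])⟩
  rw [Finset.card_image_of_injOn]
  · have htot := h.total
    rw [← Finset.sum_filter_add_sum_filter_not _ 𝒞.IsTransversal,
      Finset.sum_congr rfl fun C hC => hself C (Finset.mem_filter.1 hC).2,
      Finset.sum_eq_zero (s := 𝒞.members.filter fun C => ¬ 𝒞.IsTransversal C)] at htot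
    · simp only [Finset.sum_const, nsmul_eq_mul, add_zero] at htot
      have : ((𝒞.members.filter 𝒞.IsTransversal).card : ℝ) = 8 := by linarith
      exact_mod_cast this
    · intro C hC
      by_contra h0
      exact (Finset.mem_filter.1 hC).2 (h.isTransversal h0)
  · intro C hC D hD hCD
    by_contra hne
    have := hdist C D (Finset.mem_filter.1 hC).2 (Finset.mem_filter.1 hD).2 hne
    have hCD' : ∀ i, decide (r i ∈ C) = decide (r i ∈ D) := fun i => congrFun hCD i
    rw [Finset.filter_true_of_mem fun i _ => hCD' i] at this
    simp at this

end unique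

end Clutter

/-! ### Automorphisms of the Fano plane and words with prescribed values. -/

/-- The third point on the line of the Fano plane through two points. -/
def fanoThird (i j : Fin 7) : Fin 7 :=
  -- The diagonal entries `(i, i)` are filled with `i`; they have no geometric meaning.
  (![![0, 2, 1, 4, 3, 6, 5], ![2, 1, 0, 6, 5, 4, 3], ![1, 0, 2, 5, 6, 3, 4],
    ![4, 6, 5, 3, 0, 2, 1], ![3, 5, 6, 0, 4, 1, 2], ![6, 4, 3, 2, 1, 5, 0],
    ![5, 3, 4, 1, 2, 0, 6]] : Fin 7 → Fin 7 → Fin 7) i j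

set_option maxRecDepth 100000 in
theorem IsFanoWord.third : ∀ {q : Fin 7 → Bool}, IsFanoWord q →
    ∀ i j, i ≠ j → (q i ^^ q j) = q (fanoThird i j) := by
  decide

theorem isFanoWord_iff_third (q : Fin 7 → Bool) :
    IsFanoWord q ↔ ∀ i j, i ≠ j → (q i ^^ q j) = q (fanoThird i j) := by
  constructor
  · exact fun h => h.third
  · intro h
    exact ⟨h 0 1 (by decide), h 0 3 (by decide), h 0 5 (by decide), h 1 4 (by decide),
      h 1 3 (by decide), h 2 3 (by decide), h 2 4 (by decide)⟩

/-- The map of the Fano plane sending the points `0, 1, 3` to `i, j, l`. -/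
def fanoMap (i j l : Fin 7) : Fin 7 → Fin 7 :=
  ![i, j, fanoThird i j, l, fanoThird i l, fanoThird j (fanoThird i l), fanoThird j l]

set_option maxRecDepth 100000 in
theorem fanoMap_injective : ∀ i j l, i ≠ j → l ≠ i → l ≠ j → l ≠ fanoThird i j →
    Function.Injective (fanoMap i j l) := by
  unfold Function.Injective
  decide

-- Any three noncollinear points can be moved to any others by an automorphism. This lets statements
-- about frames be proved for fixed labels and transported.
set_option maxRecDepth 100000 in
theorem fanoMap_third : ∀ i j l, i ≠ j → l ≠ i → l ≠ j → l ≠ fanoThird i j →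
    ∀ m n, m ≠ n → fanoThird (fanoMap i j l m) (fanoMap i j l n) = fanoMap i j l (fanoThird m n) := by
  decide

/-- The word of the Fano plane with given values at the points `0, 1, 3`. -/
def fanoWord (a b c : Bool) : Fin 7 → Bool :=
  ![a, b, a ^^ b, c, a ^^ c, b ^^ (a ^^ c), b ^^ c]

theorem isFanoWord_fanoWord : ∀ a b c, IsFanoWord (fanoWord a b c) := by decide

theorem exists_isFanoWord (a b : Bool) (l : Fin 7) (hl : l ≠ 0 ∧ l ≠ 1 ∧ l ≠ 2) (c : Bool) :
    ∃ q, IsFanoWord q ∧ q 0 = a ∧ q 1 = b ∧ q 2 = (a ^^ b) ∧ q l = c := by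
  have : ∀ (a b c : Bool) (l : Fin 7), l ≠ 0 ∧ l ≠ 1 ∧ l ≠ 2 →
      ∃ x, fanoWord a b x l = c := by decide
  obtain ⟨x, hx⟩ := this a b c l hl
  exact ⟨fanoWord a b x, isFanoWord_fanoWord a b x, rfl, rfl, rfl, hx⟩

theorem exists_isFanoWord_pair (a : Bool) (l : Fin 7) (hl : l ≠ 0) (c : Bool) :
    ∃ q, IsFanoWord q ∧ q 0 = a ∧ q l = c := by
  have : ∀ (a c : Bool) (l : Fin 7), l ≠ 0 → ∃ x y, fanoWord a x y l = c := by decide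
  obtain ⟨x, y, hx⟩ := this a c l hl
  exact ⟨fanoWord a x y, isFanoWord_fanoWord a x y, rfl, hx⟩

/-- An automorphism of the Fano plane. -/
def IsFanoAut (σ : Equiv.Perm (Fin 7)) : Prop :=
  ∀ m n, m ≠ n → fanoThird (σ m) (σ n) = σ (fanoThird m n)

theorem IsFanoAut.isFanoWord_comp {σ : Equiv.Perm (Fin 7)} (hσ : IsFanoAut σ) (q : Fin 7 → Bool) :
    IsFanoWord (fun i => q (σ i)) ↔ IsFanoWord q := by
  rw [isFanoWord_iff_third, isFanoWord_iff_third]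
  constructor
  · intro h i j hij
    have := h (σ.symm i) (σ.symm j) (σ.symm.injective.ne hij)
    rwa [← hσ _ _ (σ.symm.injective.ne hij), σ.apply_symm_apply, σ.apply_symm_apply] at this
  · intro h i j hij
    rw [h _ _ (σ.injective.ne hij), hσ _ _ hij]

/-- The automorphism of the Fano plane sending the points `0, 1, 3` to `i, j, l`. -/
noncomputable def fanoAut (i j l : Fin 7)
    (h : i ≠ j ∧ l ≠ i ∧ l ≠ j ∧ l ≠ fanoThird i j) : Equiv.Perm (Fin 7) :=
  Equiv.ofBijective _ (Finite.injective_iff_bijective.1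
    (fanoMap_injective i j l h.1 h.2.1 h.2.2.1 h.2.2.2))

theorem isFanoAut_fanoAut {i j l : Fin 7} (h : i ≠ j ∧ l ≠ i ∧ l ≠ j ∧ l ≠ fanoThird i j) :
    IsFanoAut (fanoAut i j l h) :=
  fanoMap_third i j l h.1 h.2.1 h.2.2.1 h.2.2.2

/-! ### Frames: components as points of the Fano plane. -/

namespace Clutter

variable {α : Type*} [DecidableEq α] {𝒞 : Clutter α}

/-- The components of the pair graph are indexed by the points of the Fano plane, and their sides by
signs, such that the transversal members are given by the words of the Fano plane. -/
structure Frame (𝒞 : Clutter α) (X : Fin 7 → Bool → Finset α) : Prop where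
  clean : 𝒞.IsClean
  loose : 𝒞.Loose ∅ 𝒞.ground
  noIsolated : 𝒞.NoIsolated ∅ 𝒞.ground
  sub : ∀ i s, X i s ⊆ 𝒞.ground
  cover : ∀ v ∈ 𝒞.ground, ∃ i s, v ∈ X i s
  nonempty : ∀ i s, (X i s).Nonempty
  disj : ∀ {v i j s t}, v ∈ X i s → v ∈ X j t → i = j ∧ s = t
  adj : ∀ {u v i s}, u ∈ X i s → (𝒞.pairGraph ∅ 𝒞.ground).Adj u v → v ∈ X i (!s)
  conn : ∀ {u v i s t}, u ∈ X i s → v ∈ X i t →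
    (𝒞.pairGraph ∅ (X i false ∪ X i true)).ParityReachable (s ^^ t) u v
  word : ∀ q, IsFanoWord q → ∃ C ∈ 𝒞.members, ∀ i s, ∀ v ∈ X i s, (v ∈ C ↔ q i = s)
  transversal : ∀ C, 𝒞.IsTransversal C →
    ∃ q, IsFanoWord q ∧ ∀ i s, ∀ v ∈ X i s, (v ∈ C ↔ q i = s)

theorem Frame.comp_aut {X : Fin 7 → Bool → Finset α} (F : 𝒞.Frame X) {σ : Equiv.Perm (Fin 7)}
    (hσ : IsFanoAut σ) : 𝒞.Frame fun i => X (σ i) where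
  clean := F.clean
  loose := F.loose
  noIsolated := F.noIsolated
  sub i s := F.sub (σ i) s
  cover v hv := by
    obtain ⟨i, s, h⟩ := F.cover v hv
    exact ⟨σ.symm i, s, by simpa using h⟩
  nonempty i s := F.nonempty (σ i) s
  disj h h' := by
    have := F.disj h h'
    exact ⟨σ.injective this.1, this.2⟩
  adj h h' := F.adj h h'
  conn h h' := F.conn h h'
  word q hq := by
    obtain ⟨C, hC, h⟩ := F.word (fun i => q (σ.symm i))
      ((hσ.isFanoWord_comp _).1 (by simpa using hq))
    exact ⟨C, hC, fun i s v hv => by simpa using h (σ i) s v hv⟩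
  transversal C hC := by
    obtain ⟨q, hq, h⟩ := F.transversal C hC
    exact ⟨fun i => q (σ i), (hσ.isFanoWord_comp q).2 hq, fun i s v hv => h (σ i) s v hv⟩

/-- A clean tangled clutter of rank seven with a unique fractional packing of value two has a
frame. -/
theorem exists_frame (hclean : 𝒞.IsClean) (htangled : 𝒞.IsTangled) (hrank : 𝒞.rank = 7)
    (hunique : ∃! y : {C // C ∈ 𝒞.members} → ℝ,
      𝒞.IsFractionalPacking y ∧ 𝒞.packingValue y = 2) :
    ∃ X, 𝒞.Frame X := by
  classical
  have hl := htangled.loose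
  have hno := htangled.noIsolated
  have hodd := hclean.not_odd hl
  obtain ⟨r, hr, hr1, hr2⟩ := htangled.exists_representatives hrank (by norm_num)
  obtain ⟨w, hw⟩ := hclean.exists_isHalfPacking hl hno
  obtain ⟨h8, h3⟩ := transversal_words hclean hl hno
    (fun _ _ h h' => IsHalfPacking.eq_of_unique hunique h h') hw hr hr1 hr2
  obtain ⟨π, p, hπ⟩ := exists_perm_isFanoWord _ h8 (by
    intro q hq q' hq' hne
    obtain ⟨C, hC, rfl⟩ := Finset.mem_image.1 hq
    obtain ⟨D, hD, rfl⟩ := Finset.mem_image.1 hq'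
    exact h3 C D (Finset.mem_filter.1 hC).2 (Finset.mem_filter.1 hD).2 hne)
  have hmem : ∀ {C : Finset α}, 𝒞.IsTransversal C → ∀ i s, ∀ v ∈ 𝒞.side ∅ 𝒞.ground (r (π i))
      (!(s ^^ p (π i))), (v ∈ C ↔ (decide (r (π i) ∈ C) ^^ p (π i)) = s) := by
    intro C hC i s v hv
    have h1 := hC.mem_iff (mem_side.1 hv).2
    rw [← decide_eq_true_iff (p := v ∈ C), h1]
    cases decide (r (π i) ∈ C) <;> cases s <;> cases p (π i) <;> simp
  -- The sign is normalised so that the member of the word `q` contains exactly the sides `X i (q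
  -- i)`. The negation enters because the representative itself has even parity, and `p` is the
  -- translation taking the code to the Fano words.
  refine ⟨fun i s => 𝒞.side ∅ 𝒞.ground (r (π i)) (!(s ^^ p (π i))), hclean, hl, hno,
    fun i s => side_subset, ?_, ?_, ?_, ?_, ?_, ?_, ?_⟩
  · intro v hv
    obtain ⟨j, hj⟩ := hr2 v hv
    obtain ⟨b, hb⟩ := hj.exists_parity
    refine ⟨π.symm j, !(b ^^ p j), mem_side.2 ⟨hv, ?_⟩⟩
    simpa using hb
  · intro i s
    rcases hb : !(s ^^ p (π i)) with _ | _
    · exact ⟨r (π i), mem_side.2 ⟨hr _, .refl _ _⟩⟩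
    · obtain ⟨y, hy⟩ := hno _ (hr (π i))
      exact ⟨y, mem_side.2 ⟨hy.2.2.1, .of_adj hy⟩⟩
  · intro v i j s t h h'
    rw [mem_side] at h h'
    have := hr1 _ _ (h.2.reachable.trans h'.2.reachable.symm)
    obtain rfl := π.injective this
    have := SimpleGraph.ParityReachable.eq_of_bip hodd h.2 h'.2
    exact ⟨rfl, by simpa using this⟩
  · intro u v i s h h'
    rw [mem_side] at h ⊢
    exact ⟨h'.2.2.1, by simpa using h.2.trans (.of_adj h')⟩
  · intro u v i s t h h'
    have hu := (mem_side.1 h).1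
    obtain ⟨q, hq⟩ := (mem_side.1 h).2.symm.trans (mem_side.1 h').2
    have e : ((!(s ^^ p (π i))) ^^ (!(t ^^ p (π i)))) = (s ^^ t) := by
      cases s <;> cases t <;> cases p (π i) <;> rfl
    rw [← e, ← hq]
    refine parityReachable_of_support_subset q subset_rfl fun x hx => ?_
    obtain ⟨b, hb⟩ := ((mem_side.1 h).2.reachable.trans ⟨q.takeUntil x hx⟩).exists_parity
    have hxs : x ∈ 𝒞.side ∅ 𝒞.ground (r (π i)) b :=
      mem_side.2 ⟨mem_of_mem_support q hu hx, hb⟩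
    rw [Finset.mem_union]
    cases b <;> cases p (π i) <;> simp [hxs]
  · intro q hq
    have : (fun j => q (π.symm j) ^^ p j) ∈ ((𝒞.members.filter 𝒞.IsTransversal).image
        fun C i => decide (r i ∈ C)) := by
      rw [hπ]; simpa using hq
    obtain ⟨C, hC, hCq⟩ := Finset.mem_image.1 this
    rw [Finset.mem_filter] at hC
    refine ⟨C, hC.1, fun i s v hv => ?_⟩
    have h1 := congrFun hCq (π i)
    simp only [Equiv.symm_apply_apply] at h1
    rw [hmem hC.2 i s v hv, h1]
    simp
  · intro C hC
    refine ⟨fun i => decide (r (π i) ∈ C) ^^ p (π i), ?_, fun i s v hv => hmem hC i s v hv⟩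
    exact (hπ _).1 (Finset.mem_image.2 ⟨C, Finset.mem_filter.2 ⟨hC.1, hC⟩, rfl⟩)

end Clutter

/-! ### Even patterns of sides on a line are covers. -/

namespace Clutter

variable {α : Type*} [DecidableEq α] {𝒞 : Clutter α} {I R : Finset α}

/-- If two sets, each inside one side of a component of the pair graph, together with the deleted
set meet every member, then they lie on opposite sides of the same component. -/
theorem IsClean.parityReachable_of_hits (hclean : 𝒞.IsClean) (hl : 𝒞.Loose I R) {x y : α}
    {A B : Finset α} (hx : x ∈ R) (hy : y ∈ R) (hA : A ⊆ 𝒞.side I R x false)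
    (hB : B ⊆ 𝒞.side I R y false) (hit : 𝒞.Hits (I ∪ (A ∪ B))) :
    (𝒞.pairGraph I R).ParityReachable true x y := by
  -- If the components were different, both sides could be deleted one after the other without
  -- producing a cover.
  have hreach : (𝒞.pairGraph I R).Reachable x y := by
    by_contra hne
    have hy' : y ∈ R \ 𝒞.comp I R x :=
      Finset.mem_sdiff.2 ⟨hy, fun h => hne (mem_comp.1 h).2⟩
    have h1 := hclean.loose_side hl hx false
    have h2 := hclean.loose_side h1 hy' false
    refine h2.not_hits (hit.mono ?_)
    have hBs : B ⊆ 𝒞.side (I ∪ 𝒞.side I R x false) (R \ 𝒞.comp I R x) y false := by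
      intro z hz
      have hzR : ∀ u, (𝒞.pairGraph I R).Reachable y u → u ∉ 𝒞.comp I R x := fun u hu hc =>
        hne ((mem_comp.1 hc).2.trans hu.symm)
      obtain ⟨q, hq⟩ := (mem_side.1 (hB hz)).2
      refine mem_side.2 ⟨Finset.mem_sdiff.2 ⟨(mem_side.1 (hB hz)).1, hzR z ⟨q⟩⟩, ?_⟩
      rw [← hq]
      exact parityReachable_of_support_subset q Finset.subset_union_left fun u hu =>
        Finset.mem_sdiff.2 ⟨mem_of_mem_support q hy hu, hzR u ⟨q.takeUntil u hu⟩⟩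
    rw [← Finset.union_assoc]
    exact Finset.union_subset_union (Finset.union_subset_union_right hA) hBs
  obtain ⟨b, hb⟩ := hreach.exists_parity
  cases b with
  | true => exact hb
  | false =>
    refine absurd hit (hclean.not_hits_of_even hl (Finset.union_subset (hA.trans side_subset)
      (hB.trans side_subset)) ?_)
    have key : ∀ z ∈ A ∪ B, (𝒞.pairGraph I R).ParityReachable false x z := by
      intro z hz
      rcases Finset.mem_union.1 hz with hz | hz
      · exact (mem_side.1 (hA hz)).2
      · simpa using hb.trans (mem_side.1 (hB hz)).2
    intro u hu v hv
    simpa using (key u hu).symm.trans (key v hv)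

theorem mem_or_mem_of_adj {u v : α} (h : (𝒞.pairGraph I R).Adj u v) {C : Finset α}
    (hC : C ∈ 𝒞.members) (hd : Disjoint I C) : u ∈ C ∨ v ∈ C := by
  obtain ⟨t, ht⟩ := h.2.2.2 C hC
  simp only [Finset.mem_inter, Finset.mem_union, Finset.mem_insert, Finset.mem_singleton] at ht
  rcases ht.1 with h | rfl | rfl
  · exact absurd ht.2 (Finset.disjoint_left.1 hd h)
  · exact .inl ht.2
  · exact .inr ht.2

namespace Frame

variable {X Y : Fin 7 → Bool → Finset α} (F : 𝒞.Frame X)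

/-- The vertex set of a component. -/
def block (X : Fin 7 → Bool → Finset α) (i : Fin 7) : Finset α := X i false ∪ X i true

theorem mem_block {i : Fin 7} {v : α} : v ∈ block X i ↔ ∃ s, v ∈ X i s := by
  simp [block]

theorem subset_block (i : Fin 7) (s : Bool) : X i s ⊆ block X i := fun _ h => mem_block.2 ⟨s, h⟩

include F

/-- The member given by `q` avoids every side `X i s` with `q i ≠ s`. -/
theorem not_hits {q : Fin 7 → Bool} (hq : IsFanoWord q) {K : Finset α}
    (hK : ∀ v ∈ K, ∃ i s, v ∈ X i s ∧ q i ≠ s) : ¬ 𝒞.Hits K := by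
  obtain ⟨C, hC, h⟩ := F.word q hq
  refine not_hits_iff.2 ⟨C, hC, Finset.disjoint_left.2 fun v hv hvC => ?_⟩
  obtain ⟨i, s, hvX, hne⟩ := hK v hv
  exact hne ((h i s v hvX).1 hvC)

/-- For every line and every sign at one of its points, some pattern on the line is a cover. -/
theorem exists_hits_base (s : Bool) : ∃ t, 𝒞.Hits (X 0 s ∪ X 1 t ∪ X 2 (s ^^ t)) := by
  classical
  set R := 𝒞.ground \ block X 0 with hR
  have hmemR : ∀ {v i t}, v ∈ X i t → i ≠ 0 → v ∈ R := by
    intro v i t hv hi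
    refine Finset.mem_sdiff.2 ⟨F.sub _ _ hv, fun hb => ?_⟩
    obtain ⟨t', ht'⟩ := mem_block.1 hb
    exact hi (F.disj hv ht').1
  have hRmem : ∀ v ∈ R, ∃ i t, i ≠ 0 ∧ v ∈ X i t := by
    intro v hv
    rw [hR, Finset.mem_sdiff] at hv
    obtain ⟨i, t, h⟩ := F.cover v hv.1
    refine ⟨i, t, ?_, h⟩
    rintro rfl
    exact hv.2 (mem_block.2 ⟨t, h⟩)
  have hl : 𝒞.Loose (X 0 s) R := by
    refine ⟨F.sub 0 s, Finset.sdiff_subset, Finset.disjoint_of_subset_left (subset_block 0 s)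
      Finset.disjoint_sdiff, ?_, ?_⟩
    · obtain ⟨q, hq, h0, -⟩ := exists_isFanoWord_pair (!s) 1 (by decide) false
      exact F.not_hits hq fun v hv => ⟨0, s, hv, by simp [h0]⟩
    · intro v hv
      obtain ⟨i, t, hi, hvt⟩ := hRmem v hv
      obtain ⟨q, hq, h0, h1⟩ := exists_isFanoWord_pair (!s) i hi (!t)
      refine F.not_hits hq fun u hu => ?_
      rcases Finset.mem_union.1 hu with hu | hu
      · exact ⟨0, s, hu, by simp [h0]⟩
      · rw [Finset.mem_singleton.1 hu]
        exact ⟨i, t, hvt, by simp [h1]⟩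
  have hno : 𝒞.NoIsolated (X 0 s) R := by
    intro v hv
    obtain ⟨i, t, hi, hvt⟩ := hRmem v hv
    obtain ⟨z, hz⟩ := F.noIsolated v (F.sub _ _ hvt)
    exact ⟨z, hz.1, hv, hmemR (F.adj hvt hz) hi, hz.2.2.2.mono (by simp)⟩
  obtain ⟨x, hx⟩ := F.nonempty 1 false
  obtain ⟨y, hy⟩ := F.nonempty 2 s
  have hxR := hmemR hx (by decide)
  have hyR := hmemR hy (by decide)
  have hreach : (𝒞.pairGraph (X 0 s) R).Reachable x y := by
    by_contra hne
    set I₁ := X 0 s ∪ 𝒞.side (X 0 s) R x false with hI₁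
    set R₁ := R \ 𝒞.comp (X 0 s) R x with hR₁
    have hy₁ : y ∈ R₁ := Finset.mem_sdiff.2 ⟨hyR, fun h => hne (mem_comp.1 h).2⟩
    have hl₁ : 𝒞.Loose I₁ R₁ := F.clean.loose_side hl hxR false
    have hno₁ : 𝒞.NoIsolated I₁ R₁ := hno.sdiff_comp x false
    set I₂ := I₁ ∪ 𝒞.side I₁ R₁ y false with hI₂
    set R₂ := R₁ \ 𝒞.comp I₁ R₁ y with hR₂
    have hl₂ : 𝒞.Loose I₂ R₂ := F.clean.loose_side hl₁ hy₁ false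
    have hno₂ : 𝒞.NoIsolated I₂ R₂ := hno₁.sdiff_comp y false
    obtain ⟨w, hw⟩ := F.clean.exists_isHalfPacking hl₂ hno₂
    obtain ⟨C, hC⟩ : ∃ C, w C ≠ 0 := by
      by_contra! h0
      have := hw.total
      simp [h0] at this
    have hCm := (hw.supp C hC).1
    have hdis := Finset.disjoint_left.1 (hw.supp C hC).2
    have hnot : ∀ u v, (𝒞.pairGraph ∅ 𝒞.ground).Adj u v → ¬ (u ∈ C ∧ v ∈ C) := by
      rintro u v huv ⟨hu, hv⟩
      by_cases hu0 : u ∈ R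
      swap
      · have hub : u ∈ block X 0 := by
          by_contra hb; exact hu0 (Finset.mem_sdiff.2 ⟨huv.2.1, hb⟩)
        obtain ⟨t, ht⟩ := mem_block.1 hub
        have hvt := F.adj ht huv
        have : u ∈ X 0 s ∨ v ∈ X 0 s := by cases s <;> cases t <;> simp_all
        rcases this with h | h
        · exact hdis (by simp [hI₂, hI₁, h]) hu
        · exact hdis (by simp [hI₂, hI₁, h]) hv
      have hv0 : v ∈ R := by
        obtain ⟨i, t, hi, hut⟩ := hRmem u hu0
        exact hmemR (F.adj hut huv) hi
      have hadj₀ : (𝒞.pairGraph (X 0 s) R).Adj u v :=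
        ⟨huv.1, hu0, hv0, huv.2.2.2.mono (by simp)⟩
      by_cases hu1 : u ∈ R₁
      swap
      · have huc : u ∈ 𝒞.comp (X 0 s) R x := by
          by_contra hb; exact hu1 (Finset.mem_sdiff.2 ⟨hu0, hb⟩)
        obtain ⟨b, hb⟩ := mem_comp_iff_exists_side.1 huc
        have hvb : v ∈ 𝒞.side (X 0 s) R x (!b) := mem_side.2 ⟨hv0, by
          simpa using (mem_side.1 hb).2.trans (.of_adj hadj₀)⟩
        cases b
        · exact hdis (by simp [hI₂, hI₁, hb]) hu
        · exact hdis (by simp [hI₂, hI₁, show v ∈ 𝒞.side (X 0 s) R x false from hvb]) hv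
      have hv1 : v ∈ R₁ := Finset.mem_sdiff.2 ⟨hv0, fun hc => (Finset.mem_sdiff.1 hu1).2
        (mem_comp.2 ⟨hu0, (mem_comp.1 hc).2.trans hadj₀.symm.reachable⟩)⟩
      have hadj₁ : (𝒞.pairGraph I₁ R₁).Adj u v :=
        ⟨huv.1, hu1, hv1, hadj₀.2.2.2.mono
          (Finset.union_subset_union_left Finset.subset_union_left)⟩
      by_cases hu2 : u ∈ R₂
      swap
      · have huc : u ∈ 𝒞.comp I₁ R₁ y := by
          by_contra hb; exact hu2 (Finset.mem_sdiff.2 ⟨hu1, hb⟩)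
        obtain ⟨b, hb⟩ := mem_comp_iff_exists_side.1 huc
        have hvb : v ∈ 𝒞.side I₁ R₁ y (!b) := mem_side.2 ⟨hv1, by
          simpa using (mem_side.1 hb).2.trans (.of_adj hadj₁)⟩
        cases b
        · exact hdis (by simp [hI₂, hb]) hu
        · exact hdis (by simp [hI₂, show v ∈ 𝒞.side I₁ R₁ y false from hvb]) hv
      have hv2 : v ∈ R₂ := Finset.mem_sdiff.2 ⟨hv1, fun hc => (Finset.mem_sdiff.1 hu2).2
        (mem_comp.2 ⟨hu1, (mem_comp.1 hc).2.trans hadj₁.symm.reachable⟩)⟩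
      have hadj₂ : (𝒞.pairGraph I₂ R₂).Adj u v :=
        ⟨huv.1, hu2, hv2, hadj₁.2.2.2.mono
          (Finset.union_subset_union_left Finset.subset_union_left)⟩
      exact (hw.mem_iff_notMem_of_adj hadj₂ hC).1 hu hv
    have htr : 𝒞.IsTransversal C := ⟨hCm, fun u v huv => by
      have h1 := mem_or_mem_of_adj huv hCm (Finset.disjoint_empty_left _)
      have h2 := hnot u v huv
      tauto⟩
    obtain ⟨q, hq, hqC⟩ := F.transversal C htr
    obtain ⟨z, hz⟩ := F.nonempty 0 s
    have h0 : q 0 ≠ s := fun h => hdis (by simp [hI₂, hI₁, hz]) ((hqC 0 s z hz).2 h)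
    have h1 : q 1 ≠ false := fun h => hdis (by
      have : x ∈ 𝒞.side (X 0 s) R x false := mem_side.2 ⟨hxR, .refl _ _⟩
      simp [hI₂, hI₁, this]) ((hqC 1 false x hx).2 h)
    have h2 : q 2 ≠ s := fun h => hdis (by
      have : y ∈ 𝒞.side I₁ R₁ y false := mem_side.2 ⟨hy₁, .refl _ _⟩
      simp [hI₂, this]) ((hqC 2 s y hy).2 h)
    have h3 := hq.1
    revert h0 h1 h2 h3
    cases q 0 <;> cases q 1 <;> cases q 2 <;> cases s <;> simp
  obtain ⟨p⟩ := hreach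
  obtain ⟨d, -, hd1, hd2⟩ := p.exists_boundary_dart (block X 1 : Set α)
    (by simpa using subset_block 1 false hx)
    (by
      rw [Finset.mem_coe, mem_block]
      rintro ⟨t, ht⟩
      exact absurd (F.disj hy ht).1 (by decide))
  rw [Finset.mem_coe, mem_block] at hd1 hd2
  obtain ⟨t, ht⟩ := hd1
  obtain ⟨j, u, hj, hu⟩ := hRmem d.snd d.adj.2.2.1
  have hj1 : j ≠ 1 := by rintro rfl; exact hd2 ⟨u, hu⟩
  have hit := d.adj.2.2.2
  have hcontra : ∀ q, IsFanoWord q → q 0 = (!s) → q 1 = (!t) → q j = (!u) → False := by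
    intro q hq h0 h1 h2
    refine F.not_hits hq (fun v hv => ?_) hit
    rcases Finset.mem_union.1 hv with hv | hv
    · exact ⟨0, s, hv, by simp [h0]⟩
    · rcases Finset.mem_insert.1 hv with rfl | hv
      · exact ⟨1, t, ht, by simp [h1]⟩
      · rw [Finset.mem_singleton.1 hv]
        exact ⟨j, u, hu, by simp [h2]⟩
  obtain rfl : j = 2 := by
    by_contra hj2
    obtain ⟨q, hq, h0, h1, -, h3⟩ := exists_isFanoWord (!s) (!t) j ⟨hj, hj1, hj2⟩ (!u)
    exact hcontra q hq h0 h1 h3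
  obtain rfl : u = (s ^^ t) := by
    by_contra hne
    obtain ⟨q, hq, h0, h1, h2, -⟩ := exists_isFanoWord (!s) (!t) 3 (by decide) false
    refine hcontra q hq h0 h1 ?_
    rw [h2]
    revert hne
    cases s <;> cases t <;> cases u <;> simp
  refine ⟨t, hit.mono ?_⟩
  intro v hv
  simp only [Finset.mem_union, Finset.mem_insert, Finset.mem_singleton] at hv ⊢
  rcases hv with h | rfl | rfl
  · exact .inl (.inl h)
  · exact .inl (.inr ht)
  · exact .inr hu

end Frame

end Clutter

theorem fanoThird_comm : ∀ i j, fanoThird i j = fanoThird j i := by decide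

theorem fanoThird_fanoThird : ∀ i j, i ≠ j → fanoThird i (fanoThird i j) = j := by decide

theorem exists_noncollinear : ∀ i j : Fin 7, i ≠ j →
    ∃ l, i ≠ j ∧ l ≠ i ∧ l ≠ j ∧ l ≠ fanoThird i j := by decide

namespace Clutter

variable {α : Type*} [DecidableEq α] {𝒞 : Clutter α}

namespace Frame

variable {X Y : Fin 7 → Bool → Finset α} (F : 𝒞.Frame X)

include F

theorem exists_hits {i j : Fin 7} (hij : i ≠ j) (s : Bool) :
    ∃ t, 𝒞.Hits (X i s ∪ X j t ∪ X (fanoThird i j) (s ^^ t)) := by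
  obtain ⟨l, hl⟩ := exists_noncollinear i j hij
  exact (F.comp_aut (isFanoAut_fanoAut hl)).exists_hits_base s

/-- If no element of `A` completes a cover with `Y 1 b ∪ Y 2 c`, then the two complementary
patterns on the remaining points cannot both be completed inside one side of `A`. -/
theorem not_hits_both (hY : ∀ i s, Y i s ⊆ X i s) {b c : Bool}
    (h36 : ∃ t, 𝒞.Hits (Y 1 b ∪ X 3 t ∪ X 6 (b ^^ t)))
    (h45 : ∃ t, 𝒞.Hits (Y 1 b ∪ X 4 t ∪ X 5 (b ^^ t)))
    (h35 : ∃ t, 𝒞.Hits (Y 2 c ∪ X 3 t ∪ X 5 (c ^^ t)))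
    {A A₁ A₂ : Finset α} (hA : A ⊆ block X 0)
    (hAK : ∀ z ∈ A, ¬ 𝒞.Hits (Y 1 b ∪ Y 2 c ∪ {z})) {a : α} (ha : a ∈ A)
    (h₁ : ∀ z ∈ A₁, (𝒞.pairGraph ∅ A).ParityReachable false a z)
    (h₂ : ∀ z ∈ A₂, (𝒞.pairGraph ∅ A).ParityReachable false a z)
    (hA₁ : A₁ ⊆ A) (hA₂ : A₂ ⊆ A) :
    ¬ (𝒞.Hits (Y 1 b ∪ Y 2 c ∪ (A₁ ∪ (X 3 false ∪ X 4 (b ^^ c) ∪ (X 5 (!c) ∪ X 6 (!b))))) ∧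
      𝒞.Hits (Y 1 b ∪ Y 2 c ∪ (A₂ ∪ (X 3 true ∪ X 4 (!(b ^^ c)) ∪ (X 5 c ∪ X 6 b))))) := by
  classical
  rintro ⟨hit₁, hit₂⟩
  set K := Y 1 b ∪ Y 2 c with hK
  set W := block X 3 ∪ block X 4 ∪ (block X 5 ∪ block X 6) with hW
  have hWmem : ∀ {v}, v ∈ W → ∃ i s, (i ≠ 0 ∧ i ≠ 1 ∧ i ≠ 2) ∧ v ∈ X i s := by
    intro v hv
    simp only [hW, Finset.mem_union] at hv
    rcases hv with (hv | hv) | (hv | hv) <;> obtain ⟨s, hs⟩ := mem_block.1 hv <;>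
      exact ⟨_, s, by decide, hs⟩
  have hbW : ∀ {i : Fin 7}, i ≠ 0 ∧ i ≠ 1 ∧ i ≠ 2 → block X i ⊆ W := by
    intro i hi
    have : i = 3 ∨ i = 4 ∨ i = 5 ∨ i = 6 := by revert i; decide
    intro v hv
    rcases this with rfl | rfl | rfl | rfl <;> simp [hW, hv]
  have hKX : ∀ {v}, v ∈ K → v ∈ X 1 b ∨ v ∈ X 2 c := fun hv =>
    (Finset.mem_union.1 hv).imp (fun h => hY _ _ h) fun h => hY _ _ h
  have hword : ∀ {i : Fin 7} {s : Bool} {v : α}, i ≠ 0 ∧ i ≠ 1 ∧ i ≠ 2 → v ∈ X i s →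
      ¬ 𝒞.Hits (K ∪ {v}) := by
    intro i s v hi hv
    obtain ⟨q, hq, -, h1, h2, h3⟩ := exists_isFanoWord (b ^^ c) (!b) i hi (!s)
    refine F.not_hits hq fun u hu => ?_
    rcases Finset.mem_union.1 hu with hu | hu
    · rcases hKX hu with h | h
      · exact ⟨1, b, h, by simp [h1]⟩
      · exact ⟨2, c, h, by rw [h2]; cases b <;> cases c <;> decide⟩
    · rw [Finset.mem_singleton.1 hu]
      exact ⟨i, s, hv, by simp [h3]⟩
  have hl : 𝒞.Loose K (A ∪ W) := by
    refine ⟨?_, ?_, ?_, ?_, ?_⟩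
    · intro v hv
      rcases hKX hv with h | h <;> exact F.sub _ _ h
    · refine Finset.union_subset (fun v hv => ?_) fun v hv => ?_
      · obtain ⟨s, hs⟩ := mem_block.1 (hA hv)
        exact F.sub _ _ hs
      · obtain ⟨i, s, -, hs⟩ := hWmem hv
        exact F.sub _ _ hs
    · rw [Finset.disjoint_left]
      intro v hv hv'
      have : ∃ i s, (i ≠ 1 ∧ i ≠ 2) ∧ v ∈ X i s := by
        rcases Finset.mem_union.1 hv' with h | h
        · obtain ⟨s, hs⟩ := mem_block.1 (hA h)
          exact ⟨0, s, by decide, hs⟩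
        · obtain ⟨i, s, hi, hs⟩ := hWmem h
          exact ⟨i, s, hi.2, hs⟩
      obtain ⟨i, s, hi, hs⟩ := this
      rcases hKX hv with h | h
      · exact hi.1 (F.disj hs h).1
      · exact hi.2 (F.disj hs h).1
    · exact fun h => hAK a ha (h.mono Finset.subset_union_left)
    · intro v hv
      rcases Finset.mem_union.1 hv with h | h
      · exact hAK v h
      · obtain ⟨i, s, hi, hs⟩ := hWmem h
        exact hword hi hs
  set G := 𝒞.pairGraph K (A ∪ W) with hG
  have hconn : ∀ {i : Fin 7} {u v : α} {s t : Bool}, i ≠ 0 ∧ i ≠ 1 ∧ i ≠ 2 → u ∈ X i s →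
      v ∈ X i t → G.ParityReachable (s ^^ t) u v := fun hi hu hv =>
    (F.conn hu hv).mono (pairGraph_mono (Finset.empty_subset _)
      ((hbW hi).trans Finset.subset_union_right))
  have hR : ∀ {i : Fin 7} {v : α} {s : Bool}, i ≠ 0 ∧ i ≠ 1 ∧ i ≠ 2 → v ∈ X i s → v ∈ A ∪ W :=
    fun hi hv => Finset.mem_union_right _ (hbW hi (subset_block _ _ hv))
  have hstep : ∀ {i j : Fin 7} {s t : Bool} {u v : α} {S : Finset α},
      i ≠ 0 ∧ i ≠ 1 ∧ i ≠ 2 → j ≠ 0 ∧ j ≠ 1 ∧ j ≠ 2 → S ⊆ K → 𝒞.Hits (S ∪ X i s ∪ X j t) →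
      u ∈ X i s → v ∈ X j t → G.ParityReachable true u v := by
    intro i j s t u v S hi hj hS hit hu hv
    refine F.clean.parityReachable_of_hits hl (hR hi hu) (hR hj hv) (A := X i s) (B := X j t)
      (fun z hz => mem_side.2 ⟨hR hi hz, by simpa using hconn hi hu hz⟩)
      (fun z hz => mem_side.2 ⟨hR hj hz, by simpa using hconn hj hv hz⟩) (hit.mono ?_)
    rw [Finset.union_assoc]
    exact Finset.union_subset_union_left hS
  obtain ⟨x, hx⟩ := F.nonempty 3 false
  have p3 : ∀ {s v}, v ∈ X 3 s → G.ParityReachable s x v := fun hv => by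
    simpa using hconn (by decide) hx hv
  have p6 : ∀ {s v}, v ∈ X 6 s → G.ParityReachable (!(s ^^ b)) x v := by
    intro s v hv
    obtain ⟨t, ht⟩ := h36
    obtain ⟨y, hy⟩ := F.nonempty 3 t
    obtain ⟨z, hz⟩ := F.nonempty 6 (b ^^ t)
    have := ((p3 hy).trans (hstep (by decide) (by decide) Finset.subset_union_left ht hy hz)).trans
      (hconn (by decide) hz hv)
    convert this using 1
    cases t <;> cases s <;> cases b <;> rfl
  have p5 : ∀ {s v}, v ∈ X 5 s → G.ParityReachable (!(s ^^ c)) x v := by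
    intro s v hv
    obtain ⟨t, ht⟩ := h35
    obtain ⟨y, hy⟩ := F.nonempty 3 t
    obtain ⟨z, hz⟩ := F.nonempty 5 (c ^^ t)
    have := ((p3 hy).trans (hstep (by decide) (by decide) Finset.subset_union_right ht hy
      hz)).trans (hconn (by decide) hz hv)
    convert this using 1
    cases t <;> cases s <;> cases c <;> rfl
  have p4 : ∀ {s v}, v ∈ X 4 s → G.ParityReachable (s ^^ (b ^^ c)) x v := by
    intro s v hv
    obtain ⟨t, ht⟩ := h45
    obtain ⟨y, hy⟩ := F.nonempty 4 t
    obtain ⟨z, hz⟩ := F.nonempty 5 (b ^^ t)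
    have := ((p5 hz).trans (hstep (by decide) (by decide) Finset.subset_union_left ht hy
      hz).symm).trans (hconn (by decide) hy hv)
    convert this using 1
    cases t <;> cases s <;> cases b <;> cases c <;> rfl
  have hmono : 𝒞.pairGraph ∅ A ≤ G :=
    pairGraph_mono (Finset.empty_subset _) Finset.subset_union_left
  have hAR : ∀ {S : Finset α}, S ⊆ A →
      (∀ z ∈ S, (𝒞.pairGraph ∅ A).ParityReachable false a z) → S ⊆ 𝒞.side K (A ∪ W) a false :=
    fun hS h z hz => mem_side.2 ⟨Finset.mem_union_left _ (hS hz), (h z hz).mono hmono⟩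
  have haR : a ∈ A ∪ W := Finset.mem_union_left _ ha
  obtain ⟨y, hy⟩ := F.nonempty 3 true
  have e₁ : G.ParityReachable true a x := by
    refine F.clean.parityReachable_of_hits hl haR (hR (by decide) hx) (hAR hA₁ h₁) ?_ hit₁
    intro v hv
    simp only [Finset.mem_union] at hv
    rcases hv with (hv | hv) | (hv | hv)
    · exact mem_side.2 ⟨hR (by decide) hv, p3 hv⟩
    · exact mem_side.2 ⟨hR (by decide) hv, by simpa using p4 hv⟩
    · exact mem_side.2 ⟨hR (by decide) hv, by simpa using p5 hv⟩
    · exact mem_side.2 ⟨hR (by decide) hv, by simpa using p6 hv⟩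
  have e₂ : G.ParityReachable true a y := by
    refine F.clean.parityReachable_of_hits hl haR (hR (by decide) hy) (hAR hA₂ h₂) ?_ hit₂
    intro v hv
    simp only [Finset.mem_union] at hv
    rcases hv with (hv | hv) | (hv | hv)
    · exact mem_side.2 ⟨hR (by decide) hv, by simpa using (p3 hy).symm.trans (p3 hv)⟩
    · exact mem_side.2 ⟨hR (by decide) hv, by simpa using (p3 hy).symm.trans (p4 hv)⟩
    · exact mem_side.2 ⟨hR (by decide) hv, by simpa using (p3 hy).symm.trans (p5 hv)⟩
    · exact mem_side.2 ⟨hR (by decide) hv, by simpa using (p3 hy).symm.trans (p6 hv)⟩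
  -- `a` is at odd distance from both `x` and `y`, but these lie on opposite sides of component 3.
  refine F.clean.not_odd hl a ?_
  simpa using (e₁.trans (p3 hy)).trans e₂.symm

omit F in
/-- An even pattern on the line through `i` and `j` is not a cover. -/
def Missing (𝒞 : Clutter α) (X : Fin 7 → Bool → Finset α) (i j : Fin 7) (s t : Bool) : Prop :=
  ¬ 𝒞.Hits (X i s ∪ X j t ∪ X (fanoThird i j) (s ^^ t))

omit F in
theorem Missing.symm {i j : Fin 7} {s t : Bool} (h : Missing 𝒞 X i j s t) :
    Missing 𝒞 X j i t s := by
  rw [Missing, Finset.union_comm (X j t), fanoThird_comm, Bool.xor_comm]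
  exact h

omit F in
theorem Missing.third {i j : Fin 7} (hij : i ≠ j) {s t : Bool} (h : Missing 𝒞 X i j s t) :
    Missing 𝒞 X i (fanoThird i j) s (s ^^ t) := by
  rw [Missing, fanoThird_fanoThird i j hij, Finset.union_assoc, Finset.union_comm (X _ (s ^^ t)),
    ← Finset.union_assoc, show (s ^^ (s ^^ t)) = t by simp]
  exact h

/-- By `exists_hits`, fixing the sign at one point of a line leaves at most one missing pattern. Two
distinct even patterns always share the sign at some point of the line. -/
theorem missing_unique {i j : Fin 7} (hij : i ≠ j) {s t s' t' : Bool}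
    (h : Missing 𝒞 X i j s t) (h' : Missing 𝒞 X i j s' t') : s = s' ∧ t = t' := by
  have key : ∀ {i j : Fin 7}, i ≠ j → ∀ {s t t' : Bool}, Missing 𝒞 X i j s t →
      Missing 𝒞 X i j s t' → t = t' := by
    intro i j hij s t t' h h'
    by_contra hne
    obtain ⟨r, hr⟩ := F.exists_hits hij s
    have : r = t ∨ r = t' := by revert hne; cases r <;> cases t <;> cases t' <;> simp
    rcases this with rfl | rfl
    · exact h hr
    · exact h' hr
  have hne3 : fanoThird i j ≠ i := (by decide : ∀ i j, i ≠ j → fanoThird i j ≠ i) i j hij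
  by_cases hs : s = s'
  · subst hs
    exact ⟨rfl, key hij h h'⟩
  · by_cases ht : t = t'
    · subst ht
      exact ⟨key hij.symm h.symm h'.symm, rfl⟩
    · have h1 := (h.third hij).symm
      have h2 := (h'.third hij).symm
      have : (s' ^^ t') = (s ^^ t) := by
        revert hs ht; cases s <;> cases t <;> cases s' <;> cases t' <;> simp
      rw [this] at h2
      exact absurd (key hne3 h1 h2) hs

theorem missing_base {s b : Bool} (h : Missing 𝒞 X 0 1 s b) :
    ∃ c, Missing 𝒞 X 0 3 s c ∧ Missing 𝒞 X 0 5 s (!(c ^^ (s ^^ b))) := by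
  by_contra! hno
  obtain ⟨a, ha⟩ := F.nonempty 0 s
  have hK : ∀ z ∈ block X 0, ¬ 𝒞.Hits (X 1 b ∪ X 2 (s ^^ b) ∪ {z}) := by
    intro z hz hit
    obtain ⟨t, ht⟩ := mem_block.1 hz
    by_cases hts : t = s
    · subst hts
      refine h (hit.mono ?_)
      intro v hv
      simp only [Finset.mem_union, Finset.mem_singleton] at hv ⊢
      rcases hv with (h | h) | rfl
      · exact .inl (.inr h)
      · exact .inr h
      · exact .inl (.inl ht)
    · obtain ⟨q, hq, h0, h1, h2, -⟩ := exists_isFanoWord s (!b) 3 (by decide) false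
      refine F.not_hits hq (fun u hu => ?_) hit
      simp only [Finset.mem_union, Finset.mem_singleton] at hu
      rcases hu with (h | h) | rfl
      · exact ⟨1, b, h, by simp [h1]⟩
      · exact ⟨2, _, h, by rw [h2]; simp⟩
      · exact ⟨0, t, ht, by rw [h0]; exact Ne.symm hts⟩
  have hside : ∀ z ∈ X 0 s, (𝒞.pairGraph ∅ (block X 0)).ParityReachable false a z := by
    intro z hz
    simpa [block] using F.conn ha hz
  have hcl : ∀ c, 𝒞.Hits (X 1 b ∪ X 2 (s ^^ b) ∪ (X 0 s ∪ (X 3 c ∪ X 4 (s ^^ c) ∪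
      (X 5 (!(c ^^ (s ^^ b))) ∪ X 6 (!(c ^^ b)))))) := by
    intro c
    by_cases hc : Missing 𝒞 X 0 3 s c
    · refine (not_not.1 (hno c hc)).mono ?_
      have : (s ^^ !(c ^^ (s ^^ b))) = !(c ^^ b) := by
        cases s <;> cases b <;> cases c <;> rfl
      rw [this]
      change X 0 s ∪ X 5 _ ∪ X 6 _ ⊆ _
      intro v hv
      simp only [Finset.mem_union] at hv ⊢
      tauto
    · refine (not_not.1 hc).mono ?_
      change X 0 s ∪ X 3 _ ∪ X 4 _ ⊆ _
      intro v hv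
      simp only [Finset.mem_union] at hv ⊢
      tauto
  refine F.not_hits_both (Y := X) (fun _ _ => Finset.Subset.refl _)
    (F.exists_hits (i := 1) (j := 3) (by decide) b) (F.exists_hits (i := 1) (j := 4) (by decide) b)
    (F.exists_hits (i := 2) (j := 3) (by decide) (s ^^ b)) (Finset.Subset.refl _) hK
    (subset_block _ _ ha) hside hside (subset_block _ _) (subset_block _ _)
    ⟨(hcl false).mono ?_, (hcl true).mono ?_⟩ <;>
  cases s <;> cases b <;> exact Finset.Subset.refl _

theorem exists_missing {i j l : Fin 7} (h : i ≠ j ∧ l ≠ i ∧ l ≠ j ∧ l ≠ fanoThird i j) {s b : Bool}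
    (hm : Missing 𝒞 X i j s b) : ∃ c, Missing 𝒞 X i l s c ∧
      Missing 𝒞 X i (fanoThird j (fanoThird i l)) s (!(c ^^ (s ^^ b))) := by
  obtain ⟨c, h1, h2⟩ := (F.comp_aut (isFanoAut_fanoAut h)).missing_base (s := s) (b := b) hm
  refine ⟨c, h1, ?_⟩
  have h6 : fanoThird i (fanoThird j (fanoThird i l)) = fanoThird j l :=
    isFanoAut_fanoAut h 0 5 (by decide)
  rw [Missing, h6]
  exact h2

theorem not_missing_base (s b : Bool) : ¬ Missing 𝒞 X 0 1 s b := by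
  intro h
  obtain ⟨c, h03, -⟩ := F.exists_missing (l := 3) (by decide) h
  obtain ⟨c', h13, h15⟩ := F.exists_missing (l := 3) (by decide) h.symm
  obtain ⟨d, h31, -⟩ := F.exists_missing (l := 1) (by decide) h03.symm
  obtain ⟨e, h41, -⟩ := F.exists_missing (i := 4) (l := 1) (by decide)
    (h03.third (by decide)).symm
  have e₁ := (F.missing_unique (by decide) h13 h31.symm).2
  have h14 : Missing 𝒞 X 1 4 b (b ^^ !(c' ^^ (b ^^ s))) := Missing.third (j := 5) (by decide) h15
  have e₂ := (F.missing_unique (by decide) h14 h41.symm).2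
  subst e₁
  revert e₂
  cases s <;> cases b <;> cases c' <;> decide

/-- Every even pattern on a line is a cover. -/
theorem hits_line {i j : Fin 7} (hij : i ≠ j) (s t : Bool) :
    𝒞.Hits (X i s ∪ X j t ∪ X (fanoThird i j) (s ^^ t)) := by
  obtain ⟨l, hl⟩ := exists_noncollinear i j hij
  exact not_not.1 ((F.comp_aut (isFanoAut_fanoAut hl)).not_missing_base s t)

end Frame

end Clutter

/-! ### Shrinking each side to a single element. -/

/-- Given three pairs of vertex sets such that every walk joining the sets of one pair meets all the
sets of the other pairs, and such that membership propagates to the third pair, some vertex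
lies in all six sets. -/
theorem SimpleGraph.exists_mem_of_walks {V : Type*} {G : SimpleGraph V} {S : Fin 3 → Bool → Set V}
    (hne : ∀ l s, (S l s).Nonempty)
    (hconn : ∀ l, ∀ u ∈ S l false, ∀ v ∈ S l true, G.Reachable u v)
    (hmeet : ∀ l m, l ≠ m → ∀ s, ∀ u ∈ S l false, ∀ v ∈ S l true, ∀ p : G.Walk u v,
      ∃ w ∈ p.support, w ∈ S m s)
    (hprop : ∀ l m n, l ≠ m → l ≠ n → m ≠ n → ∀ c d v, v ∈ S l c → v ∈ S m d →
      v ∈ S n (c ^^ d)) :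
    ∃ v, ∀ l s, v ∈ S l s := by
  classical
  -- The walk is taken shortest over all three pairs together, so each other pair, which it must
  -- meet, can only be met at its two ends.
  have hex : ∃ N, ∃ l, ∃ u ∈ S l false, ∃ v ∈ S l true, ∃ p : G.Walk u v, p.length = N := by
    obtain ⟨u, hu⟩ := hne 0 false
    obtain ⟨v, hv⟩ := hne 0 true
    obtain ⟨p⟩ := hconn 0 u hu v hv
    exact ⟨_, 0, u, hu, v, hv, p, rfl⟩
  obtain ⟨l, u, hu, v, hv, p, hp⟩ := Nat.find_spec hex
  have hmin : ∀ m, ∀ x ∈ S m false, ∀ y ∈ S m true, ∀ q : G.Walk x y, p.length ≤ q.length :=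
    fun m x hx y hy q => hp ▸ Nat.find_min' hex ⟨m, x, hx, y, hy, q, rfl⟩
  have hends : ∀ m i j, i ≤ p.length → j ≤ p.length → p.getVert i ∈ S m false →
      p.getVert j ∈ S m true → (i = 0 ∧ j = p.length) ∨ (i = p.length ∧ j = 0) := by
    intro m i j hi hj hxi hxj
    rcases le_total i j with hij | hij
    · obtain ⟨q, hq⟩ := p.exists_segment hij hj
      have := hmin m _ hxi _ hxj q
      omega
    · obtain ⟨q, hq⟩ := p.exists_segment hij hi
      have := hmin m _ hxi _ hxj q.reverse
      rw [SimpleGraph.Walk.length_reverse] at this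
      omega
  have hpos : ∀ m, l ≠ m → (u ∈ S m false ∧ v ∈ S m true) ∨ (v ∈ S m false ∧ u ∈ S m true) := by
    intro m hm
    obtain ⟨x, hx, hxm⟩ := hmeet l m hm false u hu v hv p
    obtain ⟨y, hy, hym⟩ := hmeet l m hm true u hu v hv p
    obtain ⟨i, rfl, hi⟩ := SimpleGraph.Walk.mem_support_iff_exists_getVert.1 hx
    obtain ⟨j, rfl, hj⟩ := SimpleGraph.Walk.mem_support_iff_exists_getVert.1 hy
    rcases hends m i j hi hj hxm hym with ⟨rfl, rfl⟩ | ⟨rfl, rfl⟩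
    · exact .inl ⟨by simpa using hxm, by simpa using hym⟩
    · exact .inr ⟨by simpa using hxm, by simpa using hym⟩
  obtain ⟨m, n, hlm, hln, hmn, hall⟩ : ∃ m n, l ≠ m ∧ l ≠ n ∧ m ≠ n ∧
      ∀ k, k = l ∨ k = m ∨ k = n := (by decide : ∀ l : Fin 3, ∃ m n, l ≠ m ∧ l ≠ n ∧ m ≠ n ∧
        ∀ k, k = l ∨ k = m ∨ k = n) l
  have huv : u = v := by
    have h0 : p.length = 0 := by
      have hu' := fun h : ∀ s, u ∈ S n s => hends n 0 0 (Nat.zero_le _) (Nat.zero_le _)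
        (by simpa using h false) (by simpa using h true)
      have hv' := fun h : ∀ s, v ∈ S n s => hends n p.length p.length le_rfl le_rfl
        (by simpa using h false) (by simpa using h true)
      have hu3 := fun d h => hprop l m n hlm hln hmn false d u hu h
      have hv3 := fun d h => hprop l m n hlm hln hmn true d v hv h
      -- Each end lies in one set of each other pair. The propagation rule then puts one end into
      -- both sets of the third pair, so the walk of length zero at that end competes and the
      -- shortest walk is trivial.
      have key : (∀ s, u ∈ S n s) ∨ ∀ s, v ∈ S n s := by
        rcases hpos m hlm with ⟨h1, h2⟩ | ⟨h1, h2⟩ <;> rcases hpos n hln with ⟨h3, h4⟩ | ⟨h3, h4⟩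
        · exact .inr (Bool.forall_bool.2 ⟨hv3 _ h2, h4⟩)
        · exact .inl (Bool.forall_bool.2 ⟨hu3 _ h1, h4⟩)
        · exact .inl (Bool.forall_bool.2 ⟨h3, hu3 _ h2⟩)
        · exact .inr (Bool.forall_bool.2 ⟨h3, hv3 _ h1⟩)
      rcases key with h | h
      · have := hu' h
        omega
      · have := hv' h
        omega
    exact SimpleGraph.Walk.eq_of_length_eq_zero h0
  subst huv
  refine ⟨u, fun k => ?_⟩
  have hboth : ∀ m, l ≠ m → ∀ s, u ∈ S m s := fun m hm => by
    have := hpos m hm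
    exact Bool.forall_bool.2 ⟨by tauto, by tauto⟩
  rcases hall k with rfl | rfl | rfl
  · exact Bool.forall_bool.2 ⟨hu, hv⟩
  · exact hboth _ hlm
  · exact hboth _ hln

namespace Clutter

variable {α : Type*} [DecidableEq α] {𝒞 : Clutter α}

namespace Frame

variable {X Y : Fin 7 → Bool → Finset α} (F : 𝒞.Frame X)

/-- Every even pattern on a line is a cover. -/
def Full (𝒞 : Clutter α) (Y : Fin 7 → Bool → Finset α) : Prop :=
  ∀ i j, i ≠ j → ∀ s t, 𝒞.Hits (Y i s ∪ Y j t ∪ Y (fanoThird i j) (s ^^ t))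

theorem Full.comp_aut (hfull : Full 𝒞 Y) {σ : Equiv.Perm (Fin 7)} (hσ : IsFanoAut σ) :
    Full 𝒞 fun i => Y (σ i) := by
  intro i j hij s t
  dsimp only
  rw [← hσ i j hij]
  exact hfull _ _ (σ.injective.ne hij) s t

/-- The elements of `X 0 false` that complete a cover with `Y j s` and `Y k s`. -/
def spot (𝒞 : Clutter α) (X Y : Fin 7 → Bool → Finset α) (j k : Fin 7) (s : Bool) : Set α :=
  {v | v ∈ X 0 false ∧ 𝒞.Hits ({v} ∪ Y j s ∪ Y k s)}

theorem spot_comm (j k : Fin 7) (s : Bool) : spot 𝒞 X Y j k s = spot 𝒞 X Y k j s := by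
  unfold spot
  simp only [Finset.union_assoc, Finset.union_comm (Y j s)]

include F

theorem not_hits_of_mem_true (hY : ∀ i s, Y i s ⊆ X i s) {j : Fin 7} (hj : j ≠ 0) (s : Bool) {z : α}
    (hz : z ∈ X 0 true) : ¬ 𝒞.Hits (Y j s ∪ Y (fanoThird 0 j) s ∪ {z}) := by
  obtain ⟨q, hq, h0, h1⟩ := exists_isFanoWord_pair false j hj (!s)
  have h2 := hq.third 0 j hj.symm
  refine F.not_hits hq fun u hu => ?_
  simp only [Finset.mem_union, Finset.mem_singleton] at hu
  rcases hu with (h | h) | rfl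
  · exact ⟨j, s, hY _ _ h, by simp [h1]⟩
  · exact ⟨_, s, hY _ _ h, by rw [← h2, h0, h1]; simp⟩
  · exact ⟨0, true, hz, by simp [h0]⟩

/-- If no single element completed the cover, deleting the two other sets would leave covering
number at least two on the block of 0. The side `X 0 false` is even there, so it could not complete
the cover either, against `hfull`. -/
theorem spot_nonempty (hY : ∀ i s, Y i s ⊆ X i s) (hfull : Full 𝒞 Y) (h0 : Y 0 false = X 0 false)
    {j : Fin 7} (hj : j ≠ 0) (s : Bool) : (spot 𝒞 X Y j (fanoThird 0 j) s).Nonempty := by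
  by_contra hne
  have hno : ∀ v ∈ X 0 false, ¬ 𝒞.Hits (Y j s ∪ Y (fanoThird 0 j) s ∪ {v}) := by
    intro v hv h
    refine hne ⟨v, hv, ?_⟩
    rwa [Finset.union_assoc, Finset.union_comm]
  have hk : fanoThird 0 j ≠ 0 := (by decide : ∀ j, j ≠ 0 → fanoThird 0 j ≠ 0) j hj
  obtain ⟨x, hx⟩ := F.nonempty 0 false
  have hl : 𝒞.Loose (Y j s ∪ Y (fanoThird 0 j) s) (block X 0) := by
    refine ⟨Finset.union_subset ((hY _ _).trans (F.sub _ _)) ((hY _ _).trans (F.sub _ _)),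
      Finset.union_subset (F.sub _ _) (F.sub _ _), ?_,
      fun h => hno x hx (h.mono Finset.subset_union_left), ?_⟩
    · rw [Finset.disjoint_left]
      intro v hv hv'
      obtain ⟨t, ht⟩ := mem_block.1 hv'
      rcases Finset.mem_union.1 hv with h | h
      · exact hj (F.disj (hY _ _ h) ht).1
      · exact hk (F.disj (hY _ _ h) ht).1
    · intro z hz
      obtain ⟨t, ht⟩ := mem_block.1 hz
      cases t
      · exact hno z ht
      · exact F.not_hits_of_mem_true hY hj s ht
  refine F.clean.not_hits_of_even hl (subset_block 0 false) (fun u hu v hv =>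
    (show SimpleGraph.ParityReachable (𝒞.pairGraph ∅ (block X 0)) false u v from
      F.conn hu hv).mono (pairGraph_mono (Finset.empty_subset _) (Finset.Subset.refl _))) ?_
  have := hfull 0 j hj.symm false s
  rw [h0, Finset.union_assoc, Finset.union_comm] at this
  simpa using this

theorem not_hits_both_of_full (hY : ∀ i s, Y i s ⊆ X i s) (hfull : Full 𝒞 Y) {s : Bool}
    {A : Finset α} (hA : A ⊆ block X 0) (hAK : ∀ z ∈ A, z ∉ spot 𝒞 X Y 1 2 s) {u v : α} (hu : u ∈ A)
    (hv : v ∈ A) (huv : (𝒞.pairGraph ∅ A).ParityReachable false u v) :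
    ¬ (𝒞.Hits (Y 1 s ∪ Y 2 s ∪ ({u} ∪ (X 3 false ∪ X 4 false ∪ (X 5 (!s) ∪ X 6 (!s))))) ∧
      𝒞.Hits (Y 1 s ∪ Y 2 s ∪ ({v} ∪ (X 3 true ∪ X 4 true ∪ (X 5 s ∪ X 6 s))))) := by
  have hmono : ∀ {i j k : Fin 7} {a b c : Bool}, 𝒞.Hits (Y i a ∪ Y j b ∪ Y k c) →
      𝒞.Hits (Y i a ∪ X j b ∪ X k c) := fun h =>
    h.mono (Finset.union_subset_union (Finset.union_subset_union_right (hY _ _)) (hY _ _))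
  have := F.not_hits_both hY (b := s) (c := s)
    ⟨false, hmono (hfull 1 3 (by decide) s false)⟩ ⟨false, hmono (hfull 1 4 (by decide) s false)⟩
    ⟨false, hmono (hfull 2 3 (by decide) s false)⟩ (A₁ := {u}) (A₂ := {v}) hA ?_ hu
    (fun z hz => by rw [Finset.mem_singleton.1 hz]; exact .refl _ _)
    (fun z hz => by rwa [Finset.mem_singleton.1 hz])
    (Finset.singleton_subset_iff.2 hu) (Finset.singleton_subset_iff.2 hv)
  · simpa using this
  · intro z hz hit
    obtain ⟨t, ht⟩ := mem_block.1 (hA hz)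
    cases t
    · refine hAK z hz ⟨ht, ?_⟩
      rwa [Finset.union_assoc, Finset.union_comm]
    · exact F.not_hits_of_mem_true hY (j := 1) (by decide) s ht hit

/-- Applied to the vertices of a walk avoiding the third spot, `not_hits_both_of_full` forbids what
the two ends provide. The walk is even because both ends lie in `X 0 false`. -/
theorem exists_mem_spot_base (hY : ∀ i s, Y i s ⊆ X i s) (hfull : Full 𝒞 Y) (s : Bool) {u v : α}
    (hu : u ∈ spot 𝒞 X Y 3 4 false) (hv : v ∈ spot 𝒞 X Y 3 4 true)
    (p : (𝒞.pairGraph ∅ (block X 0)).Walk u v) : ∃ w ∈ p.support, w ∈ spot 𝒞 X Y 1 2 s := by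
  by_contra! hno
  have hub := subset_block 0 false hu.1
  have hbod : p.length.bodd = false := by
    have h1 : (𝒞.pairGraph ∅ 𝒞.ground).ParityReachable false u v :=
      (F.conn hu.1 hv.1).mono (pairGraph_mono (Finset.Subset.refl _)
        (Finset.union_subset (F.sub _ _) (F.sub _ _)))
    have h2 : (𝒞.pairGraph ∅ 𝒞.ground).ParityReachable p.length.bodd u v :=
      SimpleGraph.ParityReachable.mono (pairGraph_mono (Finset.Subset.refl _)
        (Finset.union_subset (F.sub _ _) (F.sub _ _))) ⟨p, rfl⟩
    exact h2.eq_of_bip (F.clean.not_odd F.loose) h1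
  have hpar := parityReachable_of_support_subset (I' := ∅) (R' := p.support.toFinset) p
    (Finset.Subset.refl _) fun x hx => List.mem_toFinset.2 hx
  rw [hbod] at hpar
  refine F.not_hits_both_of_full hY hfull (s := s) (A := p.support.toFinset)
    (fun x hx => mem_of_mem_support p hub (List.mem_toFinset.1 hx))
    (fun z hz => hno z (List.mem_toFinset.1 hz)) (by simp) (by simp) hpar
    ⟨hu.2.mono ?_, hv.2.mono ?_⟩ <;>
  · intro z hz
    simp only [Finset.mem_union] at hz ⊢
    rcases hz with (h | h) | h
    · exact .inr (.inl h)
    · exact .inr (.inr (.inl (.inl (hY _ _ h))))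
    · exact .inr (.inr (.inl (.inr (hY _ _ h))))

theorem mem_spot_base (hY : ∀ i s, Y i s ⊆ X i s) (hfull : Full 𝒞 Y) {c d : Bool} {v : α}
    (hc : v ∈ spot 𝒞 X Y 3 4 c) (hd : v ∈ spot 𝒞 X Y 5 6 d) : v ∈ spot 𝒞 X Y 1 2 (c ^^ d) := by
  by_contra hno
  have h₁ : ∀ S, 𝒞.Hits (Y 1 (c ^^ d) ∪ Y 2 (c ^^ d) ∪ ({v} ∪ (X 3 c ∪ X 4 c ∪ S))) := fun S => by
    refine hc.2.mono fun z hz => ?_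
    simp only [Finset.mem_union] at hz ⊢
    rcases hz with (h | h) | h
    · exact .inr (.inl h)
    · exact .inr (.inr (.inl (.inl (hY _ _ h))))
    · exact .inr (.inr (.inl (.inr (hY _ _ h))))
  have h₂ : ∀ S, 𝒞.Hits (Y 1 (c ^^ d) ∪ Y 2 (c ^^ d) ∪ ({v} ∪ (S ∪ (X 5 d ∪ X 6 d)))) := fun S => by
    refine hd.2.mono fun z hz => ?_
    simp only [Finset.mem_union] at hz ⊢
    rcases hz with (h | h) | h
    · exact .inr (.inl h)
    · exact .inr (.inr (.inr (.inl (hY _ _ h))))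
    · exact .inr (.inr (.inr (.inr (hY _ _ h))))
  refine F.not_hits_both_of_full hY hfull (s := c ^^ d) (A := {v}) (u := v) (v := v)
    (Finset.singleton_subset_iff.2 (subset_block 0 false hc.1))
    (fun z hz => by rwa [Finset.mem_singleton.1 hz]) (Finset.mem_singleton_self v)
    (Finset.mem_singleton_self v) (.refl _ _) ?_
  cases c
  · exact ⟨h₁ _, by simpa using h₂ (X 3 true ∪ X 4 true)⟩
  · exact ⟨by simpa using h₂ (X 3 false ∪ X 4 false), h₁ _⟩

theorem exists_center_base (hY : ∀ i s, Y i s ⊆ X i s) (hfull : Full 𝒞 Y)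
    (h0 : Y 0 false = X 0 false) :
    ∃ a ∈ X 0 false, ∀ j ≠ 0, ∀ s, 𝒞.Hits ({a} ∪ Y j s ∪ Y (fanoThird 0 j) s) := by
  -- One point on each of the three lines through 0; the walk lemma is applied to the two spots of
  -- each line.
  let pt : Fin 3 → Fin 7 := ![1, 3, 5]
  have hpt : ∀ l m, l ≠ m → (0 : Fin 7) ≠ pt m ∧ pt l ≠ 0 ∧ pt l ≠ pt m ∧
      pt l ≠ fanoThird 0 (pt m) := by decide
  have hthird : ∀ l m n, l ≠ m → l ≠ n → m ≠ n →
      (fanoThird (pt n) (fanoThird 0 (pt l)) = pt m ∧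
        fanoThird (pt n) (pt l) = fanoThird 0 (pt m)) ∨
      (fanoThird (pt n) (fanoThird 0 (pt l)) = fanoThird 0 (pt m) ∧
        fanoThird (pt n) (pt l) = pt m) := by decide
  have hex : ∃ v, ∀ l s, v ∈ spot 𝒞 X Y (pt l) (fanoThird 0 (pt l)) s := by
    refine SimpleGraph.exists_mem_of_walks (G := 𝒞.pairGraph ∅ (block X 0)) ?_ ?_ ?_ ?_
    · exact fun l s => F.spot_nonempty hY hfull h0 ((by decide : ∀ l, pt l ≠ 0) l) s
    · intro l u hu v hv
      exact (F.conn hu.1 hv.1).reachable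
    · intro l m hlm s u hu v hv p
      have hσ := isFanoAut_fanoAut (hpt l m hlm)
      exact (F.comp_aut hσ).exists_mem_spot_base (Y := fun i => Y (fanoAut _ _ _ (hpt l m hlm) i))
        (fun i s => hY _ _) (hfull.comp_aut hσ) s hu hv p
    · intro l m n hlm hln hmn c d v hc hd
      have hσ := isFanoAut_fanoAut (hpt l n hln)
      refine (F.comp_aut hσ).mem_spot_base (Y := fun i => Y (fanoAut _ _ _ (hpt l n hln) i))
        (fun i s => hY _ _) (hfull.comp_aut hσ) hc ?_
      change v ∈ spot 𝒞 X Y (fanoThird (pt n) (fanoThird 0 (pt l))) (fanoThird (pt n) (pt l)) d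
      rcases hthird l m n hlm hln hmn with ⟨h1, h2⟩ | ⟨h1, h2⟩
      · rw [h1, h2]; exact hd
      · rw [h1, h2, spot_comm]; exact hd
  obtain ⟨a, ha⟩ := hex
  refine ⟨a, (ha 0 false).1, fun j hj s => ?_⟩
  have : ∃ l, j = pt l ∨ (j = fanoThird 0 (pt l) ∧ fanoThird 0 j = pt l) := by
    revert j; decide
  obtain ⟨l, rfl | ⟨rfl, h⟩⟩ := this
  · exact (ha l s).2
  · rw [h]
    have := ha l s
    rw [spot_comm] at this
    exact this.2

/-- Some element of a side `X i false` can replace the side in all covers on lines through `i`. -/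
theorem exists_center (hY : ∀ i s, Y i s ⊆ X i s) (hfull : Full 𝒞 Y) {i : Fin 7}
    (hi : Y i false = X i false) :
    ∃ a ∈ X i false, ∀ j ≠ i, ∀ s, 𝒞.Hits ({a} ∪ Y j s ∪ Y (fanoThird i j) s) := by
  obtain ⟨j, l, h⟩ : ∃ j l, i ≠ j ∧ l ≠ i ∧ l ≠ j ∧ l ≠ fanoThird i j :=
    (by decide : ∀ i, ∃ j l, i ≠ j ∧ l ≠ i ∧ l ≠ j ∧ l ≠ fanoThird i j) i
  have hσ := isFanoAut_fanoAut h
  obtain ⟨a, ha, hits⟩ := (F.comp_aut hσ).exists_center_base (Y := fun m => Y (fanoAut i j l h m))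
    (fun i s => hY _ _) (hfull.comp_aut hσ) hi
  refine ⟨a, ha, fun m hm s => ?_⟩
  have hne : (fanoAut i j l h).symm m ≠ 0 := by
    intro h'
    rw [Equiv.symm_apply_eq] at h'
    exact hm h'
  have := hits _ hne s
  simp only [← hσ 0 _ hne.symm, Equiv.apply_symm_apply] at this
  exact this

-- A line either passes through `i`, where the hypothesis on `a` or the old pattern applies, or it
-- avoids `i` and is unchanged. The cases locate `i` among the three points.
omit F in
theorem Full.replace {Z : Fin 7 → Bool → Finset α} (hfull : Full 𝒞 Y) {i : Fin 7} {a : α}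
    (ha : ∀ j ≠ i, ∀ s, 𝒞.Hits ({a} ∪ Y j s ∪ Y (fanoThird i j) s)) (hi : Z i false = {a})
    (hZ : ∀ j s, j ≠ i ∨ s = true → Z j s = Y j s) : Full 𝒞 Z := by
  have key : ∀ j ≠ i, ∀ s t, 𝒞.Hits (Z i s ∪ Z j t ∪ Z (fanoThird i j) (s ^^ t)) := by
    intro j hj s t
    rw [hZ j _ (.inl hj), hZ (fanoThird i j) _
      (.inl ((by decide : ∀ i j, j ≠ i → fanoThird i j ≠ i) i j hj))]
    cases s
    · rw [hi]
      simpa using ha j hj t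
    · rw [hZ i _ (.inr rfl)]
      exact hfull i j hj.symm _ _
  intro j k hjk s t
  by_cases hj : j = i
  · subst hj
    exact key k hjk.symm s t
  by_cases hk : k = i
  · subst hk
    rw [Finset.union_comm (Z j s), fanoThird_comm, Bool.xor_comm]
    exact key j hjk t s
  by_cases hl : fanoThird j k = i
  · have h3 : fanoThird i j = k := by
      rw [← hl, fanoThird_comm, fanoThird_fanoThird j k hjk]
    have := key j hj (s ^^ t) s
    rw [h3, show ((s ^^ t) ^^ s) = t by cases s <;> cases t <;> rfl, Finset.union_assoc,
      Finset.union_comm] at this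
    rwa [hl]
  · rw [hZ j _ (.inl hj), hZ k _ (.inl hk), hZ _ _ (.inl hl)]
    exact hfull j k hjk s t

/-- There are representatives of the sides `X i false` such that every line of representatives is
a cover. -/
theorem exists_points : ∃ a : Fin 7 → α, (∀ i, a i ∈ X i false) ∧
    ∀ i j, i ≠ j → 𝒞.Hits {a i, a j, a (fanoThird i j)} := by
  classical
  -- The sides are shrunk one at a time. Only the sides with sign `false` shrink, and those with
  -- sign `true` stay whole because later steps need all even patterns.
  have key : ∀ S : Finset (Fin 7), ∃ a : Fin 7 → α, (∀ i ∈ S, a i ∈ X i false) ∧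
      Full 𝒞 fun i s => if i ∈ S ∧ s = false then {a i} else X i s := by
    intro S
    induction S using Finset.induction_on with
    | empty =>
      obtain ⟨x, -⟩ := F.nonempty 0 false
      exact ⟨fun _ => x, by simp, by simpa [Full] using fun i j hij => F.hits_line (X := X) hij⟩
    | insert i S hi ih =>
      obtain ⟨a, ha, hfull⟩ := ih
      obtain ⟨x, hx, hits⟩ := F.exists_center (i := i) (fun j s => by
        split_ifs with h
        · rw [h.2]
          exact Finset.singleton_subset_iff.2 (ha j h.1)
        · exact Finset.Subset.refl _) hfull (by simp [hi])
      refine ⟨Function.update a i x, fun j hj => ?_, hfull.replace hits (by simp) ?_⟩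
      · by_cases hji : j = i
        · subst hji
          simpa using hx
        · rw [Function.update_of_ne hji]
          exact ha j ((Finset.mem_insert.1 hj).resolve_left hji)
      · rintro j s (hj | rfl)
        · simp [hj]
        · simp
  obtain ⟨a, ha, hfull⟩ := key Finset.univ
  refine ⟨a, fun i => ha i (Finset.mem_univ i), fun i j hij => ?_⟩
  refine (hfull i j hij false false).mono ?_
  simp only [Finset.mem_univ, Bool.xor_self, and_self, if_true]
  intro v
  simp

end Frame

end Clutter

/-! ### The minor on the seven chosen elements. -/

-- The Fano plane is its own blocker: a set of points meeting every line contains a line.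
set_option maxRecDepth 100000 in
theorem exists_subset_of_forall_disjoint : ∀ S : Finset (Fin 7),
    (∀ T ∈ fanoTriples, ¬ Disjoint T S) → ∃ T ∈ fanoTriples, T ⊆ S := by
  decide

set_option maxRecDepth 100000 in
theorem card_of_mem_fanoTriples : ∀ T ∈ fanoTriples, T.card = 3 := by decide

set_option maxRecDepth 100000 in
theorem isFanoWord_of_mem_fanoTriples : ∀ T ∈ fanoTriples,
    IsFanoWord fun i => decide (i ∉ T) := by
  decide

set_option maxRecDepth 100000 in
theorem exists_fanoThird_of_mem : ∀ T ∈ fanoTriples, ∃ i j, i ≠ j ∧ T = {i, j, fanoThird i j} := by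
  decide

namespace Clutter

/-- Two clutters with the same incidences after indexing their elements are isomorphic. -/
theorem isIsomorphic_of_index {ι α β : Type*} [DecidableEq α] [DecidableEq β] [Fintype ι]
    {𝒞 : Clutter α} {𝒟 : Clutter β} {f : ι → α} {g : ι → β} (hf : f.Injective) (hg : g.Injective)
    (hf' : 𝒞.ground = Finset.univ.image f) (hg' : 𝒟.ground = Finset.univ.image g)
    (h : ∀ S : Finset ι, S.image f ∈ 𝒞.members ↔ S.image g ∈ 𝒟.members) : 𝒞.IsIsomorphic 𝒟 := by
  let e₁ : ι ≃ {v // v ∈ 𝒞.ground} := Equiv.ofBijective (fun i => ⟨f i, by simp [hf']⟩)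
    ⟨fun i j hij => hf (congrArg Subtype.val hij), fun ⟨v, hv⟩ => by
      rw [hf'] at hv
      obtain ⟨i, -, rfl⟩ := Finset.mem_image.1 hv
      exact ⟨i, rfl⟩⟩
  let e₂ : ι ≃ {v // v ∈ 𝒟.ground} := Equiv.ofBijective (fun i => ⟨g i, by simp [hg']⟩)
    ⟨fun i j hij => hg (congrArg Subtype.val hij), fun ⟨v, hv⟩ => by
      rw [hg'] at hv
      obtain ⟨i, -, rfl⟩ := Finset.mem_image.1 hv
      exact ⟨i, rfl⟩⟩
  refine ⟨e₁.symm.trans e₂, fun S => ?_⟩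
  have h₁ : S.map (Function.Embedding.subtype _) = (S.map e₁.symm.toEmbedding).image f := by
    ext v
    simp only [Finset.mem_map, Finset.mem_image, exists_exists_and_eq_and]
    exact exists_congr fun x => and_congr_right fun _ => by
      rw [show f (e₁.symm.toEmbedding x) = (e₁ (e₁.symm x)).1 from rfl, e₁.apply_symm_apply]
      rfl
  have h₂ : (S.map (e₁.symm.trans e₂).toEmbedding).map (Function.Embedding.subtype _) =
      (S.map e₁.symm.toEmbedding).image g := by
    ext v
    simp only [Finset.mem_map, Finset.mem_image, exists_exists_and_eq_and]
    rfl
  rw [h₁, h₂]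
  exact h _

set_option maxRecDepth 100000 in
theorem image_mem_fanoLines_iff : ∀ S : Finset (Fin 7),
    S.image (fun i => i.val + 1) ∈ fanoLines.members ↔ S ∈ fanoTriples := by
  decide

variable {α : Type*} [DecidableEq α] {𝒞 : Clutter α}

/-- Points of a frame all of whose lines are covers span a minor isomorphic to `𝕃₇`. -/
theorem Frame.isIsomorphic_minor {X : Fin 7 → Bool → Finset α} (F : 𝒞.Frame X) {a : Fin 7 → α}
    (ha : ∀ i, a i ∈ X i false) (hits : ∀ i j, i ≠ j → 𝒞.Hits {a i, a j, a (fanoThird i j)}) :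
    (𝒞.minor ∅ (𝒞.ground \ (∅ ∪ Finset.univ.image a))).IsIsomorphic fanoLines := by
  have hinj : a.Injective := fun i j hij => (F.disj (ha i) (hij ▸ ha j)).1
  have hR : Finset.univ.image a ⊆ 𝒞.ground := by
    intro v hv
    obtain ⟨i, -, rfl⟩ := Finset.mem_image.1 hv
    exact F.sub _ _ (ha i)
  have hsd : ∀ S : Finset (Fin 7), Finset.univ.image a \ S.image a = Sᶜ.image a := fun S => by
    rw [← Finset.image_sdiff _ _ hinj, Finset.compl_eq_univ_sdiff]
  have hnot : ∀ S : Finset (Fin 7), ¬ 𝒞.Hits (∅ ∪ (Finset.univ.image a \ S.image a)) ↔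
      ∃ T ∈ fanoTriples, T ⊆ S := by
    intro S
    rw [Finset.empty_union, hsd]
    constructor
    · refine fun h => exists_subset_of_forall_disjoint S fun T hT hd => h ?_
      obtain ⟨i, j, hij, rfl⟩ := exists_fanoThird_of_mem T hT
      refine (hits i j hij).mono ?_
      have := Finset.image_subset_image (f := a) (Finset.subset_compl_iff_disjoint_right.2 hd)
      simpa [Finset.image_insert] using this
    -- The word that is `false` exactly on `T` gives a member containing `a i` exactly for `i ∈ T`,
    -- hence disjoint from the points outside `S`.
    · rintro ⟨T, hT, hTS⟩
      refine F.not_hits (isFanoWord_of_mem_fanoTriples T hT) fun v hv => ?_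
      obtain ⟨i, hi, rfl⟩ := Finset.mem_image.1 hv
      refine ⟨i, false, ha i, ?_⟩
      simpa using fun h => Finset.mem_compl.1 hi (hTS h)
  refine isIsomorphic_of_index (f := a) (g := fun i : Fin 7 => i.val + 1) hinj
    (fun i j hij => by simpa [Fin.ext_iff] using hij)
    (minor_ground (Finset.empty_subset _) hR (Finset.disjoint_empty_left _)) (by decide)
    fun S => ?_
  rw [image_mem_fanoLines_iff,
    mem_minor_iff (Finset.empty_subset _) hR (Finset.disjoint_empty_left _)]
  constructor
  · intro h
    obtain ⟨T, hT, hTS⟩ := (hnot S).1 h.prop.2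
    have h1 := h.le_of_le ⟨Finset.image_subset_image (Finset.subset_univ T),
      (hnot T).2 ⟨T, hT, Finset.Subset.refl _⟩⟩ (Finset.image_subset_image hTS)
    rwa [Finset.Subset.antisymm ((Finset.image_subset_image_iff hinj).1 h1) hTS]
  · intro hS
    refine ⟨⟨Finset.image_subset_image (Finset.subset_univ S),
      (hnot S).2 ⟨S, hS, Finset.Subset.refl _⟩⟩, ?_⟩
    rintro D ⟨hDR, hD⟩ hDS
    obtain ⟨U, -, rfl⟩ := Finset.subset_image_iff.1 hDS
    obtain ⟨T, hT, hTU⟩ := (hnot U).1 hD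
    have hUS := (Finset.image_subset_image_iff hinj).1 hDS
    have := Finset.eq_of_subset_of_card_le (hTU.trans hUS)
      (by rw [card_of_mem_fanoTriples T hT, card_of_mem_fanoTriples S hS])
    exact Finset.image_subset_image (this ▸ hTU)

end Clutter

theorem mainTheorem11 {α : Type*} [DecidableEq α] (𝒞 : Clutter α)
    (hclean : 𝒞.IsClean) (htangled : 𝒞.IsTangled) (hrank : 𝒞.rank = 7)
    (hunique : ∃! y : {C // C ∈ 𝒞.members} → ℝ,
      𝒞.IsFractionalPacking y ∧ 𝒞.packingValue y = 2) :
    ∃ ℳ : Clutter α, ℳ.IsMinor 𝒞 ∧ ℳ.IsIsomorphic Clutter.fanoLines := by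
  obtain ⟨X, F⟩ := Clutter.exists_frame hclean htangled hrank hunique
  obtain ⟨a, ha, hits⟩ := F.exists_points
  exact ⟨_, Clutter.isMinor_minor (Finset.empty_subset _), F.isIsomorphic_minor ha hits⟩
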